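/- Let $k$ be a field, $S=k[x_1,\dots,x_n]$ with its $\mathbb Z^n$-grading ($\deg x_i$ is the $i$-th unit vector), and $\omega_S=S(-1,\dots,-1)$, i.e. $[\omega_S]_{\mathbf a}=S_{\mathbf a-(1,\dots,1)}$. A $\mathbb Z^n$-graded $S$-module $M$ is called *squarefree* if it is finitely generated, $M=\bigoplus_{\mathbf a\in\mathbb N^n}M_{\mathbf a}$, and for all $\mathbf a,\mathbf b\in\mathbb N^n$ with $\operatorname{supp}(\mathbf b)\subseteq\operatorname{supp}(\mathbf a)$ the map $M_{\mathbf a}\to M_{\mathbf a+\mathbf b}$, $y\mapsto x^{\mathbf b}y$, is bijective. For $W\subseteq[n]=\{1,\dots,n\}$ let $M|_{-W}=\bigoplus M_{\mathbf a}$, the sum being over all $\mathbf a\in\mathbb N^n$ with $\operatorname{supp}(\mathbf a)\cap W=\emptyset$, regarded as a module over $k[x_i\mid i\in[n]\setminus W]$. A nonzero finitely generated graded module over a polynomial ring is called *Cohen–Macaulay* if its depth with respect to the ideal generated by the variables (the supremum of the lengths of regular sequences in that ideal) equals its Krull dimension. For a positive integer $l$, a squarefree $S$-module $M$ is called *$l$-Cohen–Macaulay*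 if for every $W\subseteq[n]$ with $\#W<l$ the module $M|_{-W}$ is either $0$ or Cohen–Macaulay of dimension $\dim M$. For graded $S$-modules $M,N$ with $M$ finitely generated, $\operatorname{Ext}^i_S(M,N)$ is $\mathbb Z^n$-graded: its degree-$\mathbf a$ part consists of the classes of cocycles $f:P_i\to N$ with $f([P_i]_{\mathbf b})\subseteq N_{\mathbf a+\mathbf b}$ for all $\mathbf b$, where $P_\bullet$ is a graded projective resolution of $M$. **Corollary.** Let $M$ be a Cohen–Macaulay squarefree $S$-module of dimension $d$. Then $M$ is $2$-Cohen–Macaulay if and only if the $S$-module $\operatorname{Ext}_S^{n-d}(M,\omega_S)$ is generated by its degree-$0$ part. -/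

import Mathlib

open CategoryTheory

universe u v

namespace SquarefreeModule

noncomputable section

section Grading

variable (k : Type u) [Field k] {n : ℕ}

/-- The degree `a` part, `a ∈ ℤⁿ`, of the polynomial ring `S = k[x₁, …, xₙ]`, where `xᵢ` has
degree the `i`-th unit vector. -/
def polyDeg (a : Fin n → ℤ) : AddSubgroup (MvPolynomial (Fin n) k) :=
  (MvPolynomial.weightedHomogeneousSubmodule k
    (fun i : Fin n => (Pi.single i 1 : Fin n → ℤ)) a).toAddSubgroup

/-- The `ℤⁿ`-grading of the canonical module `ω_S = S(-1, …, -1)`: its underlying `S`-module is `S`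
and `[ω_S]_a = S_{a - (1, …, 1)}`. -/
def canonicalDeg (a : Fin n → ℤ) : AddSubgroup (MvPolynomial (Fin n) k) :=
  polyDeg k (a - 1)

/-- An exponent vector in `ℕⁿ`, seen in `ℤⁿ`. -/
def expZ (a : Fin n →₀ ℕ) : Fin n → ℤ := fun i => (a i : ℤ)

variable {k}

lemma C_mem_polyDeg (c : k) : MvPolynomial.C c ∈ polyDeg k (0 : Fin n → ℤ) :=
  MvPolynomial.isWeightedHomogeneous_C _ c

lemma X_mem_polyDeg (i : Fin n) :
    (MvPolynomial.X i : MvPolynomial (Fin n) k) ∈ polyDeg k (Pi.single i 1 : Fin n → ℤ) :=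
  MvPolynomial.isWeightedHomogeneous_X k _ i

/-- The family `ℳ` of additive subgroups is a `ℤⁿ`-grading of the `S`-module `M`:
`M = ⨁_a M_a` and `S_a M_b ⊆ M_{a+b}`. -/
structure IsGrading {M : Type v} [AddCommGroup M] [Module (MvPolynomial (Fin n) k) M]
    (ℳ : (Fin n → ℤ) → AddSubgroup M) : Prop where
  isInternal : DirectSum.IsInternal ℳ
  smul_mem : ∀ (a b : Fin n → ℤ), ∀ f ∈ polyDeg k a, ∀ y ∈ ℳ b, f • y ∈ ℳ (a + b)

end Grading

section Squarefree

variable {k : Type u} [Field k] {n : ℕ} {M : Type v} [AddCommGroup M]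
  [Module (MvPolynomial (Fin n) k) M]

/-- Squarefree modules over `S = k[x₁, …, xₙ]`: finitely generated `ℤⁿ`-graded modules,
concentrated in degrees in `ℕⁿ`, such that `M_a → M_{a+b}`, `y ↦ x^b y`, is bijective whenever
`a, b ∈ ℕⁿ` and `supp b ⊆ supp a`. -/
structure IsSquarefree (ℳ : (Fin n → ℤ) → AddSubgroup M) : Prop
    extends IsGrading (k := k) ℳ where
  finite : Module.Finite (MvPolynomial (Fin n) k) M
  eq_bot : ∀ a : Fin n → ℤ, ¬ 0 ≤ a → ℳ a = ⊥
  bijOn : ∀ a b : Fin n →₀ ℕ, b.support ⊆ a.support →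
    Set.BijOn (fun y : M => MvPolynomial.monomial b (1 : k) • y)
      (ℳ (expZ a) : Set M) (ℳ (expZ (a + b)) : Set M)

/-- The additive group `⨁ M_a`, the sum being over all `a ∈ ℕⁿ` with `supp a ⊆ W`. -/
def restrictAux (ℳ : (Fin n → ℤ) → AddSubgroup M) (W : Set (Fin n)) : AddSubgroup M :=
  ⨆ (a : Fin n →₀ ℕ) (_ : (a.support : Set (Fin n)) ⊆ W), ℳ (expZ a)

lemma mem_restrictAux {ℳ : (Fin n → ℤ) → AddSubgroup M} {W : Set (Fin n)} {a : Fin n →₀ ℕ}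
    (ha : (a.support : Set (Fin n)) ⊆ W) {y : M} (hy : y ∈ ℳ (expZ a)) : y ∈ restrictAux ℳ W :=
  (le_iSup₂_of_le (f := fun (a : Fin n →₀ ℕ) (_ : (a.support : Set (Fin n)) ⊆ W) => ℳ (expZ a))
    a ha le_rfl) hy

lemma smul_mem_restrictAux_of_forall {ℳ : (Fin n → ℤ) → AddSubgroup M} {W : Set (Fin n)}
    (f : MvPolynomial (Fin n) k)
    (h : ∀ a : Fin n →₀ ℕ, (a.support : Set (Fin n)) ⊆ W → ∀ y ∈ ℳ (expZ a),
      f • y ∈ restrictAux ℳ W) :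
    ∀ y ∈ restrictAux ℳ W, f • y ∈ restrictAux ℳ W := by
  have : restrictAux ℳ W ≤ (restrictAux ℳ W).comap (DistribSMul.toAddMonoidHom M f) :=
    iSup₂_le fun a ha y hy => h a ha y hy
  exact fun y hy => this hy

lemma smul_mem_restrictAux {ℳ : (Fin n → ℤ) → AddSubgroup M} (hℳ : IsGrading (k := k) ℳ)
    {W : Set (Fin n)} {f : MvPolynomial (Fin n) k} (hf : f ∈ MvPolynomial.supported k W) :
    ∀ y ∈ restrictAux ℳ W, f • y ∈ restrictAux ℳ W := by
  classical
  induction hf using Algebra.adjoin_induction with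
  | mem f hf =>
    obtain ⟨i, hi, rfl⟩ := hf
    refine smul_mem_restrictAux_of_forall _ fun a ha y hy => ?_
    refine mem_restrictAux (a := a + Finsupp.single i 1) ?_ ?_
    · intro j hj
      by_cases hji : j = i
      · exact hji ▸ hi
      · refine ha ?_
        simpa [Finsupp.single_apply, Ne.symm hji] using hj
    · have := hℳ.smul_mem _ _ _ (X_mem_polyDeg (k := k) i) y hy
      convert this using 2
      funext j
      simp [expZ, Finsupp.single_apply, Pi.single_apply, eq_comm, add_comm]
  | algebraMap c =>
    refine smul_mem_restrictAux_of_forall _ fun a ha y hy => mem_restrictAux ha ?_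
    have := hℳ.smul_mem _ _ _ (C_mem_polyDeg c) y hy
    rwa [zero_add] at this
  | add f g _ _ hf hg =>
    intro y hy
    rw [add_smul]
    exact add_mem (hf y hy) (hg y hy)
  | mul f g _ _ hf hg =>
    intro y hy
    rw [mul_smul]
    exact hf _ (hg y hy)

/-- The restriction `M|_W = ⨁_{a ∈ ℕⁿ, supp a ⊆ W} M_a`, as a module over the polynomial ring
`S|_W = k[xᵢ ∣ i ∈ W]`, which is realized as the subring `MvPolynomial.supported k W` of `S`. -/
def restrict {ℳ : (Fin n → ℤ) → AddSubgroup M} (hℳ : IsGrading (k := k) ℳ) (W : Set (Fin n)) :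
    Submodule (MvPolynomial.supported k W) M where
  __ := restrictAux ℳ W
  smul_mem' f y hy := smul_mem_restrictAux hℳ f.2 y hy

end Squarefree

section CohenMacaulay

/-- The `I`-depth of a module `N`: the supremum of the lengths of `N`-regular sequences in `I`. -/
def depth {R : Type u} [CommRing R] (I : Ideal R) (N : Type v) [AddCommGroup N] [Module R N] :
    ℕ∞ :=
  ⨆ (rs : List R) (_ : (∀ r ∈ rs, r ∈ I) ∧ RingTheory.Sequence.IsRegular N rs), (rs.length : ℕ∞)

/-- Cohen–Macaulay modules over a graded ring `R` with graded maximal ideal `I` (for finitely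
generated graded modules): the `I`-depth equals the Krull dimension. The zero module, whose
dimension is `⊥`, is excluded. -/
def IsCohenMacaulay {R : Type u} [CommRing R] (I : Ideal R) (N : Type v) [AddCommGroup N]
    [Module R N] : Prop :=
  (depth I N : WithBot ℕ∞) = Module.supportDim R N

/-- The submodule `N` is either zero or a Cohen–Macaulay module of dimension `d`. -/
def IsZeroOrCohenMacaulayOfDim {R : Type u} [CommRing R] (I : Ideal R) {M : Type v}
    [AddCommGroup M] [Module R M] (N : Submodule R M) (d : WithBot ℕ∞) : Prop :=
  N = ⊥ ∨ (IsCohenMacaulay I N ∧ Module.supportDim R N = d)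

variable (k : Type u) [Field k] {n : ℕ}

/-- The graded maximal ideal `(x₁, …, xₙ)` of `S`. -/
def maxIdeal (n : ℕ) : Ideal (MvPolynomial (Fin n) k) :=
  Ideal.span (Set.range MvPolynomial.X)

/-- The graded maximal ideal `(xᵢ ∣ i ∈ W)` of `S|_W`. -/
def maxIdealOn (W : Set (Fin n)) : Ideal (MvPolynomial.supported k W) :=
  Ideal.span {f | ∃ i ∈ W, (f : MvPolynomial (Fin n) k) = MvPolynomial.X i}

variable {k} {M : Type v} [AddCommGroup M] [Module (MvPolynomial (Fin n) k) M]

/-- A squarefree module `M` is `l`-Cohen–Macaulay if for each `W ⊆ [n]` with `#W < l` the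
restriction `M|_{[n] \ W}` is either zero or a Cohen–Macaulay `S|_{[n] \ W}`-module of dimension
`dim M`. -/
def IsHigherCohenMacaulay {ℳ : (Fin n → ℤ) → AddSubgroup M} (hℳ : IsSquarefree (k := k) ℳ)
    (l : ℕ) : Prop :=
  ∀ W : Finset (Fin n), W.card < l →
    IsZeroOrCohenMacaulayOfDim (maxIdealOn k (W : Set (Fin n))ᶜ)
      (restrict hℳ.toIsGrading (W : Set (Fin n))ᶜ) (Module.supportDim (MvPolynomial (Fin n) k) M)

end CohenMacaulay

section Ext

variable {k : Type u} [Field k] {n : ℕ} {M : Type u} [AddCommGroup M]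
  [Module (MvPolynomial (Fin n) k) M]

/-- A `ℤⁿ`-graded projective resolution of the graded module `(M, ℳ)`: a projective resolution
whose terms are graded and whose differentials and augmentation preserve degrees. -/
structure GradedResolution (ℳ : (Fin n → ℤ) → AddSubgroup M) where
  res : ProjectiveResolution (ModuleCat.of (MvPolynomial (Fin n) k) M)
  deg : ∀ i : ℕ, (Fin n → ℤ) → AddSubgroup (res.complex.X i)
  isGrading : ∀ i, IsGrading (k := k) (deg i)
  d_mem : ∀ (i j : ℕ) (a : Fin n → ℤ), ∀ y ∈ deg i a, (res.complex.d i j).hom y ∈ deg j a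
  π_mem : ∀ a : Fin n → ℤ, ∀ y ∈ deg 0 a,
    (res.π.f 0 ≫ (HomologicalComplex.singleObjXSelf (ComplexShape.down ℕ) 0
      (ModuleCat.of (MvPolynomial (Fin n) k) M)).hom).hom y ∈ ℳ a

/-- The degree `a` part of `Ext^i_S(M, N)` for graded modules `(M, ℳ)` and `(N, 𝒩)`: the classes of
cocycles `f : P_i → N` that are homogeneous of degree `a`, i.e. `f ([P_i]_b) ⊆ N_{a+b}` for all `b`,
where `P` is a graded projective resolution of `M`. The set does not depend on the choice of
the resolution; all of them are allowed here. -/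
def extDeg (ℳ : (Fin n → ℤ) → AddSubgroup M) {N : Type u} [AddCommGroup N]
    [Module (MvPolynomial (Fin n) k) N] (𝒩 : (Fin n → ℤ) → AddSubgroup N) (i : ℕ)
    (a : Fin n → ℤ) :
    Set (Abelian.Ext (ModuleCat.of (MvPolynomial (Fin n) k) M)
      (ModuleCat.of (MvPolynomial (Fin n) k) N) i) :=
  {e | ∃ (P : GradedResolution (k := k) ℳ)
      (f : P.res.complex.X i ⟶ ModuleCat.of (MvPolynomial (Fin n) k) N)
      (hf : P.res.complex.d (i + 1) i ≫ f = 0),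
      (∀ b : Fin n → ℤ, ∀ y ∈ P.deg i b, f.hom y ∈ 𝒩 (a + b)) ∧
        P.res.extMk f (i + 1) rfl hf = e}

/-- `Ext^i_S(M, N)` is generated, as an `S`-module, by its degree `0` part. -/
def ExtGeneratedInDegreeZero (ℳ : (Fin n → ℤ) → AddSubgroup M) {N : Type u} [AddCommGroup N]
    [Module (MvPolynomial (Fin n) k) N] (𝒩 : (Fin n → ℤ) → AddSubgroup N) (i : ℕ) : Prop :=
  Submodule.span (MvPolynomial (Fin n) k) (extDeg (k := k) ℳ 𝒩 i 0) = ⊤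

end Ext

end

end SquarefreeModule

/-!
Write `S = k[x₁, …, xₙ]`, `m = (x₁, …, xₙ)` and `E^j(M) = Ext^j(M, ω)`.

*Squarefree modules.* A squarefree module is generated in squarefree degrees, so it is covered by
a free squarefree module, and the kernel of the cover is squarefree again. Hence it has a graded
resolution `P` by squarefree free modules (`IsSq.exists_gradedResolution`). A homogeneous map
`P_j → ω` whose `i`-th degree is at least `2` is divisible by `xᵢ`, and it vanishes if its `i`-th
degree is negative; therefore `E^j(M)` is squarefree (`isSq_extSubgroup`).

*The submodule of positive `i`-th degree.* Fix `i` and let `M'` be the module `⨁_{aᵢ ≥ 1} M_a`,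
shifted by the `i`-th unit vector. It is squarefree and even constant in the direction `i`, so that
`E^j(M')` vanishes in degrees with `aᵢ ≤ 0` (`eq_zero_of_mem_extSubgroup`). Multiplication by `xᵢ`
on `M` and on `M'` factors through the inclusion `M' → M` and a map `M → M'`. Squarefreeness of both
`Ext` modules turns this into the equivalence (`extMap_subtype_surjective_iff`): the restriction
`E^j(M) → E^j(M')` is surjective if and only if multiplication by `xᵢ` maps `E^j(M)_a` onto
`E^j(M)_{a+eᵢ}` for all `a` with `aᵢ = 0`. Since a squarefree module is generated in degree `0`
if and only if the latter holds for all `i` (`span_degree_zero_eq_top_iff`), generation of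
`E^{n-d}(M)` in degree `0` means that all these restriction maps in degree `j = n - d` are
surjective.

*Depth.* A nonzero finitely generated graded module `X` has a regular sequence of length `t` in
`m` if and only if `Ext^j(X, S) = 0` for all `j > n - t`. Both directions are local at `m`; instead
of localizing, modules are considered up to annihilation by an element of `1 + m` (`VanishesNear`),
which is harmless for graded modules (`IsGrading.subsingleton_of_vanishesNear`). The input from the
polynomial ring is that `m` is generated by the regular sequence `x₁, …, xₙ`, which yields the
required values of `Ext^j(S/m, S)` (`vanishesNear_ext_residue`).

*Conclusion.* The quotient `Q = M / ⨁_{aᵢ ≥ 1} M_a` is the restriction of `M` to `[n] \ {i}`,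
with `xᵢ` acting as zero; depth and dimension do not depend on whether `xᵢ` belongs to the ring
(`isZeroOrCohenMacaulayOfDim_restrict_iff`). As `M` is Cohen–Macaulay of dimension `d`,
`E^j(M) = 0` for `j > n - d`, and the long exact sequence of `0 → M' → M → Q → 0` shows that
`E^j(Q) = 0` for all `j > n - d` if and only if all the restriction maps `E^j(M) → E^j(M')` with
`j ≥ n - d` are surjective. Only `j = n - d` matters here: for `j > n - d` the divisibility criterion
holds trivially because `E^j(M) = 0`. Finally `dim Q ≤ d`, so `E^j(Q) = 0` for `j > n - d` says that
`Q` is zero or Cohen–Macaulay of dimension `d`.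
-/

namespace SquarefreeModule

/-! ### Internal direct sums of additive subgroups -/

section Internal

variable {ι : Type*} [DecidableEq ι] {M : Type*} [AddCommGroup M]

lemma exists_finset_sum_of_mem_iSup {ℳ : ι → AddSubgroup M} {y : M} (hy : y ∈ ⨆ a, ℳ a) :
    ∃ (s : Finset ι) (f : ι → M), (∀ a, f a ∈ ℳ a) ∧ ∑ a ∈ s, f a = y := by
  induction hy using AddSubgroup.iSup_induction' with
  | hp a y hy =>
    refine ⟨{a}, fun b => if b = a then y else 0, fun b => ?_, by simp⟩
    dsimp only
    split_ifs with h
    · exact h ▸ hy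
    · exact zero_mem _
  | h1 => exact ⟨∅, 0, fun _ => zero_mem _, rfl⟩
  | hadd y z _ _ hy hz =>
    obtain ⟨s, f, hf, rfl⟩ := hy
    obtain ⟨t, g, hg, rfl⟩ := hz
    refine ⟨s ∪ t, fun a => (if a ∈ s then f a else 0) + (if a ∈ t then g a else 0),
      fun a => add_mem (by split_ifs <;> simp [hf]) (by split_ifs <;> simp [hg]), ?_⟩
    rw [Finset.sum_add_distrib, Finset.sum_ite_mem, Finset.sum_ite_mem]
    simp

/-- A family of additive subgroups is an internal direct sum as soon as it spans and a finite sum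
of elements of different members vanishes only if all its terms do. -/
lemma isInternal_of_sum_eq_zero {ℳ : ι → AddSubgroup M} (hsup : ∀ y : M, y ∈ ⨆ a, ℳ a)
    (hind : ∀ (s : Finset ι) (f : ι → M), (∀ a, f a ∈ ℳ a) → ∑ a ∈ s, f a = 0 →
      ∀ a ∈ s, f a = 0) : DirectSum.IsInternal ℳ := by
  classical
  refine ⟨(injective_iff_map_eq_zero _).2 fun x hx => ?_, fun y => ?_⟩
  · rw [DirectSum.coeAddMonoidHom_eq_dfinsuppSum] at hx
    ext a
    by_cases ha : a ∈ DFinsupp.support x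
    · exact hind _ (fun a => (x a : M)) (fun a => (x a).2) hx a ha
    · simpa using ha
  · obtain ⟨s, f, hf, rfl⟩ := exists_finset_sum_of_mem_iSup (hsup y)
    exact ⟨∑ a ∈ s, DirectSum.of (fun a => ℳ a) a ⟨f a, hf a⟩, by simp⟩

/-- A family of additive subgroups is an internal direct sum as soon as it spans and there are
additive maps which behave like the projections onto its members. -/
lemma isInternal_of_proj {ℳ : ι → AddSubgroup M} (hsup : ∀ y : M, y ∈ ⨆ a, ℳ a)
    (π : ι → M →+ M) (hπ : ∀ a, ∀ y ∈ ℳ a, π a y = y)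
    (hπ' : ∀ a b, b ≠ a → ∀ y ∈ ℳ b, π a y = 0) : DirectSum.IsInternal ℳ := by
  refine isInternal_of_sum_eq_zero hsup fun s f hf h a ha => ?_
  have := congrArg (π a) h
  rw [map_sum, map_zero, Finset.sum_eq_single_of_mem a ha (fun b _ hb => hπ' a b hb _ (hf b)),
    hπ a _ (hf a)] at this
  exact this

variable {ℳ : ι → AddSubgroup M} (h : DirectSum.IsInternal ℳ)

/-- The projection of an internal direct sum of additive subgroups onto its member `ℳ a`. -/
noncomputable def proj (a : ι) : M →+ M :=
  let e : DirectSum ι (fun a => ℳ a) ≃+ M := AddEquiv.ofBijective (DirectSum.coeAddMonoidHom ℳ) h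
  (ℳ a).subtype.comp ((DFinsupp.evalAddMonoidHom a).comp e.symm.toAddMonoidHom)

lemma proj_coeAddMonoidHom (a : ι) (x : DirectSum ι (fun a => ℳ a)) :
    proj h a (DirectSum.coeAddMonoidHom ℳ x) = x a := by
  change (((AddEquiv.ofBijective (DirectSum.coeAddMonoidHom ℳ) h).symm
    ((AddEquiv.ofBijective (DirectSum.coeAddMonoidHom ℳ) h) x) a : ℳ a) : M) = x a
  rw [AddEquiv.symm_apply_apply]

lemma proj_mem (a : ι) (y : M) : proj h a y ∈ ℳ a := SetLike.coe_mem _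

lemma proj_of_mem {a : ι} {y : M} (hy : y ∈ ℳ a) : proj h a y = y := by
  have := proj_coeAddMonoidHom h a (DirectSum.of (fun a => ℳ a) a ⟨y, hy⟩)
  rwa [DirectSum.coeAddMonoidHom_of, DirectSum.of_eq_same] at this

lemma proj_of_mem_ne {a b : ι} (hab : a ≠ b) {y : M} (hy : y ∈ ℳ a) : proj h b y = 0 := by
  have := proj_coeAddMonoidHom h b (DirectSum.of (fun a => ℳ a) a ⟨y, hy⟩)
  rwa [DirectSum.coeAddMonoidHom_of, DirectSum.of_eq_of_ne _ _ _ hab.symm] at this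

lemma exists_sum_proj (y : M) : ∃ s : Finset ι, ∑ a ∈ s, proj h a y = y := by
  classical
  obtain ⟨x, rfl⟩ := h.2 y
  refine ⟨DFinsupp.support x, ?_⟩
  simp only [proj_coeAddMonoidHom]
  exact (DirectSum.coeAddMonoidHom_eq_dfinsuppSum _ _).symm

include h in
lemma mem_iSup_of_isInternal (y : M) : y ∈ ⨆ a, ℳ a := by
  obtain ⟨s, hs⟩ := exists_sum_proj h y
  rw [← hs]
  exact sum_mem fun a _ => AddSubgroup.mem_iSup_of_mem a (proj_mem h a y)

include h in
/-- Induction on sums of homogeneous elements. -/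
@[elab_as_elim]
lemma homogeneous_induction {p : M → Prop} (zero : p 0) (add : ∀ y z, p y → p z → p (y + z))
    (mem : ∀ a, ∀ y ∈ ℳ a, p y) (y : M) : p y :=
  AddSubgroup.iSup_induction ℳ (C := p) (mem_iSup_of_isInternal h y) mem zero add

/-- An element all of whose components vanish is zero. -/
lemma eq_zero_of_proj_eq_zero {y : M} (hy : ∀ a, proj h a y = 0) : y = 0 := by
  obtain ⟨s, hs⟩ := exists_sum_proj h y
  rw [← hs]
  exact Finset.sum_eq_zero fun a _ => hy a

/-- The terms of a finite sum of homogeneous elements are its components. -/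
lemma proj_sum_of_mem (s : Finset ι) (f : ι → M) (hf : ∀ a ∈ s, f a ∈ ℳ a) {a : ι} (ha : a ∈ s) :
    proj h a (∑ b ∈ s, f b) = f a := by
  rw [map_sum, Finset.sum_eq_single_of_mem a ha
    (fun b hb hb' => proj_of_mem_ne h hb' (hf b hb)), proj_of_mem h (hf a ha)]

lemma exists_forall_notMem_proj_eq_zero (y : M) :
    ∃ s : Finset ι, (∀ a ∉ s, proj h a y = 0) ∧ ∑ a ∈ s, proj h a y = y := by
  obtain ⟨s, hs⟩ := exists_sum_proj h y
  refine ⟨s, fun a ha => ?_, hs⟩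
  rw [← hs, map_sum]
  exact Finset.sum_eq_zero fun b hb =>
    proj_of_mem_ne h (ne_of_mem_of_not_mem hb ha) (proj_mem h b y)

end Internal

/-! ### Homogeneous polynomials -/

section Poly

open MvPolynomial

variable {k : Type u} [Field k] {n : ℕ}

lemma weight_single (m : Fin n →₀ ℕ) :
    Finsupp.weight (fun i : Fin n => (Pi.single i 1 : Fin n → ℤ)) m = expZ m := by
  funext i
  simp [Finsupp.weight_apply, Finsupp.sum_fintype, expZ, Pi.single_apply]

lemma mem_polyDeg_iff {a : Fin n → ℤ} {p : MvPolynomial (Fin n) k} :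
    p ∈ polyDeg k a ↔ ∀ m, coeff m p ≠ 0 → expZ m = a := by
  simp only [← weight_single]
  exact Iff.rfl

lemma expZ_add (a b : Fin n →₀ ℕ) : expZ (a + b) = expZ a + expZ b := by
  funext i
  simp [expZ]

lemma expZ_single (i : Fin n) : expZ (Finsupp.single i 1) = Pi.single i 1 := by
  funext j
  simp [expZ, Finsupp.single_apply, Pi.single_apply, eq_comm]

lemma expZ_injective : Function.Injective (expZ (n := n)) := fun a b h => by
  ext i
  have := congrFun h i
  simpa [expZ] using this

lemma expZ_nonneg (a : Fin n →₀ ℕ) : 0 ≤ expZ a := fun i => by simp [expZ]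

lemma exists_expZ_eq {a : Fin n → ℤ} (ha : 0 ≤ a) : ∃ b, expZ b = a :=
  ⟨Finsupp.equivFunOnFinite.symm fun i => (a i).toNat, by
    funext i
    simp only [expZ, Finsupp.equivFunOnFinite_symm_apply_apply]
    exact Int.toNat_of_nonneg (ha i)⟩

lemma monomial_mem_polyDeg (m : Fin n →₀ ℕ) (c : k) : monomial m c ∈ polyDeg k (expZ m) := by
  classical
  rw [mem_polyDeg_iff]
  intro m' h
  rw [coeff_monomial] at h
  split_ifs at h with hm
  · rw [hm]
  · exact absurd rfl h

lemma eq_zero_of_mem_polyDeg {a : Fin n → ℤ} (ha : ¬ 0 ≤ a) {p : MvPolynomial (Fin n) k}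
    (hp : p ∈ polyDeg k a) : p = 0 := by
  ext m
  by_contra h
  exact ha (mem_polyDeg_iff.1 hp m h ▸ expZ_nonneg m)

lemma mul_mem_polyDeg {a b : Fin n → ℤ} {p q : MvPolynomial (Fin n) k} (hp : p ∈ polyDeg k a)
    (hq : q ∈ polyDeg k b) : p * q ∈ polyDeg k (a + b) :=
  IsWeightedHomogeneous.mul hp hq

lemma isInternal_polyDeg : DirectSum.IsInternal (polyDeg k (n := n)) := by
  classical
  refine isInternal_of_proj (fun p => ?_)
    (fun a => (weightedHomogeneousComponent
      (fun i : Fin n => (Pi.single i 1 : Fin n → ℤ)) a).toAddMonoidHom) ?_ ?_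
  · rw [p.as_sum]
    exact sum_mem fun m _ => AddSubgroup.mem_iSup_of_mem _ (monomial_mem_polyDeg m _)
  · intro a p hp
    exact IsWeightedHomogeneous.weightedHomogeneousComponent_same hp
  · intro a b hab p hp
    exact IsWeightedHomogeneous.weightedHomogeneousComponent_ne _ hp hab.symm

lemma isInternal_canonicalDeg : DirectSum.IsInternal (canonicalDeg k (n := n)) := by
  refine isInternal_of_proj (fun p => ?_) (fun a => proj isInternal_polyDeg (a - 1)) ?_ ?_
  · refine homogeneous_induction isInternal_polyDeg (zero_mem _) (fun _ _ => add_mem)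
      (fun a p hp => ?_) p
    refine AddSubgroup.mem_iSup_of_mem (a + 1) ?_
    rw [canonicalDeg, add_sub_cancel_right]
    exact hp
  · intro a p hp
    exact proj_of_mem _ hp
  · intro a b hab p hp
    exact proj_of_mem_ne _ (fun h => hab (sub_left_injective h)) hp

lemma isGrading_canonicalDeg : IsGrading (k := k) (canonicalDeg k (n := n)) where
  isInternal := isInternal_canonicalDeg
  smul_mem a b f hf y hy := by
    have := mul_mem_polyDeg hf hy
    rwa [← add_sub_assoc] at this

/-- Multiplication by `xᵢ` raises the `i`-th degree by one. -/
lemma IsGrading.X_smul_mem {M : Type v} [AddCommGroup M] [Module (MvPolynomial (Fin n) k) M]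
    {ℳ : (Fin n → ℤ) → AddSubgroup M} (hℳ : IsGrading (k := k) ℳ) (i : Fin n) {a : Fin n → ℤ}
    {y : M} (hy : y ∈ ℳ a) :
    (X i : MvPolynomial (Fin n) k) • y ∈ ℳ (a + Pi.single i 1) := by
  rw [add_comm]
  exact hℳ.smul_mem _ _ _ (X_mem_polyDeg i) y hy

lemma mem_polyDeg_of_X_mul_mem {i : Fin n} {a : Fin n → ℤ} {p : MvPolynomial (Fin n) k}
    (h : X i * p ∈ polyDeg k (a + Pi.single i 1)) : p ∈ polyDeg k a := by
  rw [mem_polyDeg_iff] at h ⊢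
  intro m hm
  have := h (Finsupp.single i 1 + m) (by rwa [coeff_X_mul])
  rw [expZ_add, expZ_single, add_comm] at this
  exact add_right_cancel this

/-- A homogeneous polynomial of positive `i`-th degree is divisible by `xᵢ`. -/
lemma X_dvd_of_mem_polyDeg {i : Fin n} {a : Fin n → ℤ} (ha : 1 ≤ a i) {p : MvPolynomial (Fin n) k}
    (h : p ∈ polyDeg k a) : X i ∣ p := by
  rw [X_dvd_iff_modMonomial_eq_zero]
  ext m
  rw [coeff_zero]
  by_cases hm : Finsupp.single i 1 ≤ m
  · exact coeff_modMonomial_of_le _ hm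
  · rw [coeff_modMonomial_of_not_le _ hm]
    by_contra hc
    apply hm
    rw [Finsupp.single_le_iff]
    have := congrFun (mem_polyDeg_iff.1 h m hc) i
    simp only [expZ] at this
    omega

end Poly

/-! ### Homogeneous components of linear maps between graded modules -/

section HomComp

variable {k : Type u} [Field k] {n : ℕ} {L M N : Type*} [AddCommGroup L] [AddCommGroup M]
  [AddCommGroup N] [Module (MvPolynomial (Fin n) k) L] [Module (MvPolynomial (Fin n) k) M]
  [Module (MvPolynomial (Fin n) k) N] {ℒ : (Fin n → ℤ) → AddSubgroup L}
  {ℳ : (Fin n → ℤ) → AddSubgroup M} {𝒩 : (Fin n → ℤ) → AddSubgroup N}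

variable (ℳ 𝒩) in
/-- The linear map `f` is homogeneous of degree `a`: it maps `M_b` into `N_{a+b}`. -/
def IsHomogeneousMap (a : Fin n → ℤ) (f : M →ₗ[MvPolynomial (Fin n) k] N) : Prop :=
  ∀ b : Fin n → ℤ, ∀ y ∈ ℳ b, f y ∈ 𝒩 (a + b)

/-- Multiplication by a homogeneous polynomial shifts components. -/
lemma proj_smul (hℳ : IsGrading (k := k) ℳ) {a : Fin n → ℤ} {s : MvPolynomial (Fin n) k}
    (hs : s ∈ polyDeg k a) (b : Fin n → ℤ) (y : M) :
    proj hℳ.isInternal (a + b) (s • y) = s • proj hℳ.isInternal b y := by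
  refine homogeneous_induction hℳ.isInternal (by simp) (fun y z hy hz => ?_)
    (fun c y hy => ?_) y
  · rw [smul_add, map_add, map_add, smul_add, hy, hz]
  · have := hℳ.smul_mem _ _ _ hs _ hy
    by_cases hcb : c = b
    · subst hcb
      rw [proj_of_mem _ this, proj_of_mem _ hy]
    · rw [proj_of_mem_ne _ (fun h => hcb (add_left_cancel h)) this, proj_of_mem_ne _ hcb hy,
        smul_zero]

lemma IsHomogeneousMap.proj_map {hℳ : DirectSum.IsInternal ℳ} {h𝒩 : DirectSum.IsInternal 𝒩}
    {a : Fin n → ℤ} {f : M →ₗ[MvPolynomial (Fin n) k] N} (hf : IsHomogeneousMap ℳ 𝒩 a f)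
    (b : Fin n → ℤ) (y : M) : proj h𝒩 (a + b) (f y) = f (proj hℳ b y) := by
  refine homogeneous_induction hℳ (by simp) (fun y z hy hz => ?_) (fun c y hy => ?_) y
  · rw [map_add, map_add, map_add, map_add, hy, hz]
  · by_cases hcb : c = b
    · subst hcb
      rw [proj_of_mem _ (hf _ _ hy), proj_of_mem _ hy]
    · rw [proj_of_mem_ne _ (fun h => hcb (add_left_cancel h)) (hf _ _ hy), proj_of_mem_ne _ hcb hy,
        map_zero]

/-- Linear maps which agree on homogeneous elements are equal. -/
lemma linearMap_ext_of_homogeneous (hℳ : DirectSum.IsInternal ℳ)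
    {f g : M →ₗ[MvPolynomial (Fin n) k] N} (h : ∀ b, ∀ y ∈ ℳ b, f y = g y) : f = g :=
  LinearMap.ext fun y => homogeneous_induction hℳ (p := fun y => f y = g y) (by simp)
    (fun y z hy hz => by rw [map_add, map_add, hy, hz]) h y

/-- The additive map which is `y ↦ f(y)_{a+b}` on `M_b`. -/
noncomputable def homCompAux (hℳ : DirectSum.IsInternal ℳ) (h𝒩 : DirectSum.IsInternal 𝒩)
    (a : Fin n → ℤ) (f : M →ₗ[MvPolynomial (Fin n) k] N) : M →+ N :=
  let e : DirectSum _ (fun a => ℳ a) ≃+ M := AddEquiv.ofBijective (DirectSum.coeAddMonoidHom ℳ) hℳ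
  (DirectSum.toAddMonoid fun b =>
    ((proj h𝒩 (a + b)).comp f.toAddMonoidHom).comp (ℳ b).subtype).comp e.symm.toAddMonoidHom

lemma homCompAux_of_mem (hℳ : DirectSum.IsInternal ℳ) (h𝒩 : DirectSum.IsInternal 𝒩)
    (a : Fin n → ℤ) (f : M →ₗ[MvPolynomial (Fin n) k] N) {b : Fin n → ℤ} {y : M}
    (hy : y ∈ ℳ b) : homCompAux hℳ h𝒩 a f y = proj h𝒩 (a + b) (f y) := by
  have : (AddEquiv.ofBijective (DirectSum.coeAddMonoidHom ℳ) hℳ).symm y =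
      DirectSum.of (fun a => ℳ a) b ⟨y, hy⟩ := by
    rw [AddEquiv.symm_apply_eq]
    exact (DirectSum.coeAddMonoidHom_of ℳ b ⟨y, hy⟩).symm
  change DirectSum.toAddMonoid _
    ((AddEquiv.ofBijective (DirectSum.coeAddMonoidHom ℳ) hℳ).symm y) = _
  rw [this, DirectSum.toAddMonoid_of]
  rfl

/-- The degree `a` component of a linear map between graded modules: the homogeneous linear map
of degree `a` given by `y ↦ f(y)_{a+b}` on `M_b`. -/
noncomputable def homComp (hℳ : IsGrading (k := k) ℳ) (h𝒩 : IsGrading (k := k) 𝒩)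
    (a : Fin n → ℤ) (f : M →ₗ[MvPolynomial (Fin n) k] N) : M →ₗ[MvPolynomial (Fin n) k] N where
  __ := homCompAux hℳ.isInternal h𝒩.isInternal a f
  map_smul' s y := by
    change homCompAux _ _ a f (s • y) = s • homCompAux _ _ a f y
    refine homogeneous_induction hℳ.isInternal (by simp) (fun y z hy hz => ?_)
      (fun b y hy => ?_) y
    · rw [smul_add, map_add, map_add, smul_add, hy, hz]
    refine homogeneous_induction isInternal_polyDeg (by simp) (fun s t hs ht => ?_)
      (fun c s hs => ?_) s
    · rw [add_smul, map_add, hs, ht, add_smul]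
    · rw [homCompAux_of_mem _ _ _ _ hy, homCompAux_of_mem _ _ _ _ (hℳ.smul_mem _ _ _ hs _ hy),
        map_smul, ← proj_smul h𝒩 hs]
      congr 2
      abel

variable (hℒ : IsGrading (k := k) ℒ) (hℳ : IsGrading (k := k) ℳ) (h𝒩 : IsGrading (k := k) 𝒩)

lemma homComp_of_mem (a : Fin n → ℤ) (f : M →ₗ[MvPolynomial (Fin n) k] N) {b : Fin n → ℤ} {y : M}
    (hy : y ∈ ℳ b) : homComp hℳ h𝒩 a f y = proj h𝒩.isInternal (a + b) (f y) :=
  homCompAux_of_mem _ _ a f hy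

lemma isHomogeneousMap_homComp (a : Fin n → ℤ) (f : M →ₗ[MvPolynomial (Fin n) k] N) :
    IsHomogeneousMap ℳ 𝒩 a (homComp hℳ h𝒩 a f) := fun b y hy => by
  rw [homComp_of_mem _ _ _ _ hy]
  exact proj_mem _ _ _

lemma homComp_eq_self {a : Fin n → ℤ} {f : M →ₗ[MvPolynomial (Fin n) k] N}
    (hf : IsHomogeneousMap ℳ 𝒩 a f) : homComp hℳ h𝒩 a f = f :=
  linearMap_ext_of_homogeneous hℳ.isInternal fun b y hy => by
    rw [homComp_of_mem _ _ _ _ hy, proj_of_mem _ (hf b y hy)]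

lemma homComp_eq_zero {a b : Fin n → ℤ} (hab : a ≠ b) {f : M →ₗ[MvPolynomial (Fin n) k] N}
    (hf : IsHomogeneousMap ℳ 𝒩 a f) : homComp hℳ h𝒩 b f = 0 :=
  linearMap_ext_of_homogeneous hℳ.isInternal fun c y hy => by
    rw [homComp_of_mem _ _ _ _ hy, proj_of_mem_ne _ (fun h => hab (add_right_cancel h)) (hf c y hy),
      LinearMap.zero_apply]

lemma homComp_zero (a : Fin n → ℤ) :
    homComp hℳ h𝒩 a (0 : M →ₗ[MvPolynomial (Fin n) k] N) = 0 :=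
  linearMap_ext_of_homogeneous hℳ.isInternal fun c y hy => by
    simp [homComp_of_mem _ _ _ _ hy]

lemma homComp_sum {ι : Type*} (a : Fin n → ℤ) (s : Finset ι)
    (f : ι → M →ₗ[MvPolynomial (Fin n) k] N) :
    homComp hℳ h𝒩 a (∑ i ∈ s, f i) = ∑ i ∈ s, homComp hℳ h𝒩 a (f i) :=
  linearMap_ext_of_homogeneous hℳ.isInternal fun c y hy => by
    simp [homComp_of_mem _ _ _ _ hy, LinearMap.sum_apply]

/-- Components are compatible with composition with a homogeneous map on the right. -/
lemma homComp_comp_right (a : Fin n → ℤ) {c : Fin n → ℤ} (f : M →ₗ[MvPolynomial (Fin n) k] N)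
    {g : L →ₗ[MvPolynomial (Fin n) k] M} (hg : IsHomogeneousMap ℒ ℳ c g) :
    homComp hℒ h𝒩 (a + c) (f ∘ₗ g) = homComp hℳ h𝒩 a f ∘ₗ g :=
  linearMap_ext_of_homogeneous hℒ.isInternal fun b y hy => by
    rw [homComp_of_mem _ _ _ _ hy, LinearMap.comp_apply, LinearMap.comp_apply,
      homComp_of_mem _ _ _ _ (hg b y hy), add_assoc]

/-- Components are compatible with composition with a homogeneous map on the left. -/
lemma homComp_comp_left (a : Fin n → ℤ) {c : Fin n → ℤ} (f : L →ₗ[MvPolynomial (Fin n) k] M)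
    {g : M →ₗ[MvPolynomial (Fin n) k] N} (hg : IsHomogeneousMap ℳ 𝒩 c g) :
    homComp hℒ h𝒩 (c + a) (g ∘ₗ f) = g ∘ₗ homComp hℒ hℳ a f :=
  linearMap_ext_of_homogeneous hℒ.isInternal fun b y hy => by
    rw [homComp_of_mem _ _ _ _ hy, LinearMap.comp_apply, LinearMap.comp_apply,
      homComp_of_mem _ _ _ _ hy, add_assoc, hg.proj_map (hℳ := hℳ.isInternal)]

lemma exists_sum_homComp_apply (f : M →ₗ[MvPolynomial (Fin n) k] N) (y : M) :
    ∃ s : Finset (Fin n → ℤ), (∀ a ∉ s, homComp hℳ h𝒩 a f y = 0) ∧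
      ∑ a ∈ s, homComp hℳ h𝒩 a f y = f y := by
  classical
  refine homogeneous_induction hℳ.isInternal ⟨∅, by simp⟩ ?_ (fun b y hy => ?_) y
  · rintro y z ⟨s, hs, hs'⟩ ⟨t, ht, ht'⟩
    refine ⟨s ∪ t, fun a ha => ?_, ?_⟩
    · rw [Finset.mem_union, not_or] at ha
      rw [map_add, hs a ha.1, ht a ha.2, add_zero]
    · simp only [map_add, Finset.sum_add_distrib]
      rw [← Finset.sum_subset Finset.subset_union_left fun a _ ha => hs a ha, hs',
        ← Finset.sum_subset Finset.subset_union_right fun a _ ha => ht a ha, ht']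
  · obtain ⟨s, hs, hs'⟩ := exists_forall_notMem_proj_eq_zero h𝒩.isInternal (f y)
    simp only [homComp_of_mem _ _ _ _ hy]
    refine ⟨s.map (Equiv.subRight b).toEmbedding, fun a ha => hs _ fun h => ha ?_, ?_⟩
    · rw [Finset.mem_map_equiv]
      simpa using h
    · rw [Finset.sum_map]
      simpa using hs'

/-- A linear map from a finitely generated graded module to a graded module is the sum of finitely
many of its components. -/
lemma exists_sum_homComp [Module.Finite (MvPolynomial (Fin n) k) M]
    (f : M →ₗ[MvPolynomial (Fin n) k] N) :
    ∃ s : Finset (Fin n → ℤ), ∑ a ∈ s, homComp hℳ h𝒩 a f = f := by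
  classical
  obtain ⟨T, hT⟩ := Module.Finite.fg_top (R := MvPolynomial (Fin n) k) (M := M)
  choose s hs hs' using exists_sum_homComp_apply hℳ h𝒩 f
  refine ⟨T.biUnion s, LinearMap.ext_on hT fun y hy => ?_⟩
  rw [LinearMap.sum_apply, ← Finset.sum_subset (Finset.subset_biUnion_of_mem s hy)
    fun a _ ha => hs y a ha, hs' y]

end HomComp

/-! ### Squarefree gradings -/

section IsSq

open MvPolynomial

variable {k : Type u} [Field k] {n : ℕ}

/-- A finitely generated `ℤⁿ`-graded module which lives in degrees in `ℕⁿ` and for which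
`xᵢ : M_a → M_{a+eᵢ}` is bijective whenever `a ∈ ℕⁿ` and either `aᵢ ≥ 1` or `i ∈ T`. For `T = ∅`
these are the squarefree modules; a larger `T` makes the module constant in the directions of `T`,
so that it is generated in degrees which vanish on `T`. -/
structure IsSq {M : Type v} [AddCommGroup M] [Module (MvPolynomial (Fin n) k) M]
    (T : Set (Fin n)) (ℳ : (Fin n → ℤ) → AddSubgroup M) : Prop
    extends IsGrading (k := k) ℳ where
  finite : Module.Finite (MvPolynomial (Fin n) k) M
  eq_bot : ∀ a : Fin n → ℤ, ¬ 0 ≤ a → ℳ a = ⊥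
  bijOn : ∀ (a : Fin n → ℤ) (i : Fin n), 0 ≤ a → (1 ≤ a i ∨ i ∈ T) →
    Set.BijOn (fun y : M => (X i : MvPolynomial (Fin n) k) • y) (ℳ a : Set M)
      (ℳ (a + Pi.single i 1) : Set M)

section

variable {M : Type v} [AddCommGroup M] [Module (MvPolynomial (Fin n) k) M]
  {ℳ : (Fin n → ℤ) → AddSubgroup M} {T : Set (Fin n)}

lemma IsSquarefree.isSq (hM : IsSquarefree (k := k) ℳ) : IsSq (k := k) ∅ ℳ where
  toIsGrading := hM.toIsGrading
  finite := hM.finite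
  eq_bot := hM.eq_bot
  bijOn a i ha hi := by
    obtain ⟨a, rfl⟩ := exists_expZ_eq ha
    have := hM.bijOn a (Finsupp.single i 1) ?_
    · rwa [expZ_add, expZ_single] at this
    · refine Finsupp.support_single_subset.trans ?_
      simp only [expZ, Set.mem_empty_iff_false, or_false] at hi
      rw [Finset.singleton_subset_iff, Finsupp.mem_support_iff]
      omega

variable (ℳ) in
/-- The induced grading of a submodule. -/
noncomputable def subDeg (K : Submodule (MvPolynomial (Fin n) k) M) (a : Fin n → ℤ) :
    AddSubgroup K :=
  (ℳ a).comap K.subtype.toAddMonoidHom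

lemma mem_subDeg {K : Submodule (MvPolynomial (Fin n) k) M} {a : Fin n → ℤ} {y : K} :
    y ∈ subDeg ℳ K a ↔ (y : M) ∈ ℳ a := Iff.rfl

/-- A submodule which contains the components of its elements is graded. -/
lemma IsGrading.submodule (hℳ : IsGrading (k := k) ℳ) {K : Submodule (MvPolynomial (Fin n) k) M}
    (hK : ∀ y ∈ K, ∀ a, proj hℳ.isInternal a y ∈ K) : IsGrading (k := k) (subDeg ℳ K) where
  isInternal := by
    refine isInternal_of_proj (fun y => ?_) (fun a =>
      ((proj hℳ.isInternal a).comp K.subtype.toAddMonoidHom).codRestrict K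
        fun y => hK y y.2 a) (fun a y hy => ?_) (fun a b hab y hy => ?_)
    · obtain ⟨s, hs⟩ := exists_sum_proj hℳ.isInternal (y : M)
      have : y = ∑ a ∈ s, ⟨proj hℳ.isInternal a y, hK y y.2 a⟩ := by
        ext
        rw [AddSubmonoidClass.coe_finsetSum]
        exact hs.symm
      rw [this]
      exact sum_mem fun a _ => AddSubgroup.mem_iSup_of_mem a (mem_subDeg.2 (proj_mem _ a _))
    · exact Subtype.ext (proj_of_mem hℳ.isInternal hy)
    · exact Subtype.ext (proj_of_mem_ne hℳ.isInternal hab hy)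
  smul_mem a b f hf y hy := hℳ.smul_mem a b f hf y hy

end

section Kernel

variable {M N : Type v} [AddCommGroup M] [Module (MvPolynomial (Fin n) k) M] [AddCommGroup N]
  [Module (MvPolynomial (Fin n) k) N] {ℳ : (Fin n → ℤ) → AddSubgroup M}
  {𝒩 : (Fin n → ℤ) → AddSubgroup N} {T : Set (Fin n)}

/-- The kernel of a homogeneous map of degree `0` between squarefree modules is squarefree. -/
lemma IsSq.ker (hM : IsSq (k := k) T ℳ) (hN : IsSq (k := k) T 𝒩)
    {f : M →ₗ[MvPolynomial (Fin n) k] N} (hf : IsHomogeneousMap ℳ 𝒩 0 f) :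
    IsSq (k := k) T (subDeg ℳ (LinearMap.ker f)) where
  toIsGrading := hM.toIsGrading.submodule fun y hy a => by
    have := hf.proj_map (hℳ := hM.isInternal) (h𝒩 := hN.isInternal) a y
    rw [LinearMap.mem_ker.1 hy, map_zero] at this
    exact this.symm
  finite := by
    have := hM.finite
    infer_instance
  eq_bot a ha := by
    rw [eq_bot_iff]
    intro y hy
    have : (y : M) ∈ ℳ a := hy
    rw [hM.eq_bot a ha, AddSubgroup.mem_bot] at this
    exact Subtype.ext this
  bijOn a i ha hi := by
    refine ⟨fun y hy => (hM.bijOn a i ha hi).mapsTo hy, fun y hy z hz h => ?_, fun y hy => ?_⟩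
    · exact Subtype.ext ((hM.bijOn a i ha hi).injOn hy hz (congrArg Subtype.val h))
    · obtain ⟨z, hz, hzy⟩ := (hM.bijOn a i ha hi).surjOn hy
      have hz0 : f z ∈ 𝒩 a := by simpa using hf a z hz
      refine ⟨⟨z, ?_⟩, hz, Subtype.ext hzy⟩
      refine (hN.bijOn a i ha hi).injOn hz0 (zero_mem _) ?_
      have : f y = 0 := y.2
      simp only [smul_zero, ← map_smul]
      rw [← this]
      exact congrArg f hzy

end Kernel

/-! ### Free covers -/

section Free

lemma eq_of_X_mul_eq {i : Fin n} {p q : MvPolynomial (Fin n) k}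
    (h : (X i : MvPolynomial (Fin n) k) * p = X i * q) : p = q := by
  rw [← sub_eq_zero, ← mul_sub] at h
  exact sub_eq_zero.1 ((mul_eq_zero.1 h).resolve_left (X_ne_zero i))

lemma X_smul_pi_injective {ι : Type*} (i : Fin n) :
    Function.Injective fun v : ι → MvPolynomial (Fin n) k =>
      (X i : MvPolynomial (Fin n) k) • v := fun v w h => by
  funext l
  have := congrFun h l
  simp only [Pi.smul_apply, smul_eq_mul] at this
  exact eq_of_X_mul_eq this

/-- The grading of the free module on generators `e_l` of degree `F l`. -/
def freeDeg {ι : Type u} (F : ι → Fin n → ℤ) (a : Fin n → ℤ) :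
    AddSubgroup (ι → MvPolynomial (Fin n) k) where
  carrier := {v | ∀ l, v l ∈ polyDeg k (a - F l)}
  add_mem' hv hw l := add_mem (hv l) (hw l)
  zero_mem' _ := zero_mem _
  neg_mem' hv l := neg_mem (hv l)

variable {ι : Type u} [Finite ι] {F : ι → Fin n → ℤ} {T : Set (Fin n)}

lemma isInternal_freeDeg : DirectSum.IsInternal (freeDeg (k := k) F) := by
  classical
  have := Fintype.ofFinite ι
  refine isInternal_of_proj (fun v => ?_) (fun a => AddMonoidHom.pi fun l =>
    (proj isInternal_polyDeg (a - F l)).comp (Pi.evalAddMonoidHom _ l)) (fun a v hv => ?_)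
    (fun a b hab v hv => ?_)
  · rw [← Finset.univ_sum_single v]
    refine sum_mem fun l _ => ?_
    generalize v l = p
    refine homogeneous_induction isInternal_polyDeg (by simp) (fun p q hp hq => ?_)
      (fun a p hp => ?_) p
    · rw [Pi.single_add]
      exact add_mem hp hq
    · refine AddSubgroup.mem_iSup_of_mem (a + F l) fun l' => ?_
      by_cases h : l' = l
      · subst h
        simpa using hp
      · rw [Pi.single_eq_of_ne h]
        exact zero_mem _
  · funext l
    exact proj_of_mem _ (hv l)
  · funext l
    exact proj_of_mem_ne _ (fun h => hab (sub_left_injective h)) (hv l)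

/-- Free modules on generators of squarefree degrees which vanish on `T`. -/
lemma isSq_freeDeg (h0 : ∀ l, 0 ≤ F l) (h1 : ∀ l i, F l i ≤ 1) (hT : ∀ l, ∀ i ∈ T, F l i = 0) :
    IsSq (k := k) T (freeDeg (k := k) F) where
  isInternal := isInternal_freeDeg
  smul_mem a b f hf v hv l := by
    rw [add_sub_assoc]
    exact mul_mem_polyDeg hf (hv l)
  finite := inferInstance
  eq_bot a ha := by
    rw [eq_bot_iff]
    refine fun v hv => funext fun l => eq_zero_of_mem_polyDeg (fun h => ha ?_) (hv l)
    exact (h0 l).trans (sub_nonneg.1 h)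
  bijOn a i ha hi := by
    refine ⟨fun v hv l => ?_, fun v _ w _ h => ?_, fun v hv => ?_⟩
    · simp only [Pi.smul_apply, smul_eq_mul]
      have := mul_mem_polyDeg (X_mem_polyDeg (k := k) i) (hv l)
      rw [add_comm, ← add_sub_right_comm] at this
      exact this
    · exact X_smul_pi_injective i h
    · have h (l : ι) : X i ∣ v l := by
        refine X_dvd_of_mem_polyDeg (a := a + Pi.single i 1 - F l) ?_ (hv l)
        have h0 := ha i
        have h1 := h1 l i
        simp only [Pi.zero_apply, Pi.sub_apply, Pi.add_apply, Pi.single_eq_same] at h0 ⊢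
        rcases hi with hi | hi
        · omega
        · rw [hT l i hi]
          omega
      choose w hw using h
      refine ⟨w, fun l => mem_polyDeg_of_X_mul_mem (i := i) ?_, funext fun l => ?_⟩
      swap
      · simp only [Pi.smul_apply, smul_eq_mul, hw l]
      rw [← hw l, ← add_sub_right_comm]
      exact hv l

variable {M : Type u} [AddCommGroup M] [Module (MvPolynomial (Fin n) k) M]
  {ℳ : (Fin n → ℤ) → AddSubgroup M}

/-- A squarefree module is generated by its elements of squarefree degrees: elements of other
degrees are divisible by a variable. -/
lemma IsSq.mem_span (hM : IsSq (k := k) T ℳ) (y : M) :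
    y ∈ Submodule.span (MvPolynomial (Fin n) k)
      {g : M | ∃ F : Fin n → ℤ, 0 ≤ F ∧ (∀ i, F i ≤ 1) ∧ (∀ i ∈ T, F i = 0) ∧ g ∈ ℳ F} := by
  refine homogeneous_induction hM.isInternal (zero_mem _) (fun _ _ => add_mem)
    (fun a y hy => ?_) y
  by_cases ha : 0 ≤ a
  swap
  · rw [hM.eq_bot a ha, AddSubgroup.mem_bot] at hy
    exact hy ▸ zero_mem _
  obtain ⟨m, hm⟩ : ∃ m : ℕ, ∑ i, a i = m := ⟨(∑ i, a i).toNat,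
    (Int.toNat_of_nonneg (Finset.sum_nonneg fun i _ => ha i)).symm⟩
  induction m generalizing a y with
  | zero =>
    have h0 : ∀ i, a i = 0 := fun i =>
      (Finset.sum_eq_zero_iff_of_nonneg fun i _ => ha i).1 hm i (Finset.mem_univ i)
    exact Submodule.subset_span ⟨a, ha, fun i => by simp [h0], fun i _ => h0 i, hy⟩
  | succ m ih =>
    by_cases h : ∀ i, a i ≤ 1 ∧ (i ∈ T → a i = 0)
    · exact Submodule.subset_span ⟨a, ha, fun i => (h i).1, fun i hi => (h i).2 hi, hy⟩
    push Not at h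
    obtain ⟨i, hi⟩ := h
    have hai := ha i
    simp only [Pi.zero_apply] at hai
    have hi1 : 1 ≤ a i := by
      by_contra hlt
      exact (hi (by omega)).2 (by omega)
    have ha' : 0 ≤ a - Pi.single i 1 := fun j => by
      by_cases hj : j = i
      · subst hj
        simpa using hi1
      · simpa [hj] using ha j
    have hb := hM.bijOn (a - Pi.single i 1) i ha' (by
      by_cases h2 : a i ≤ 1
      · exact Or.inr (hi h2).1
      · left
        simp only [Pi.sub_apply, Pi.single_eq_same]
        omega)
    rw [sub_add_cancel] at hb
    obtain ⟨z, hz, rfl⟩ := hb.surjOn hy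
    refine Submodule.smul_mem _ _ (ih _ z hz ha' ?_)
    simp only [Pi.sub_apply, Finset.sum_sub_distrib, hm, Finset.sum_pi_single', Finset.mem_univ]
    simp

/-- A squarefree module is the image of a free one of the same kind. -/
lemma IsSq.exists_free_cover (hM : IsSq (k := k) T ℳ) :
    ∃ (ι : Type u) (_ : Finite ι) (F : ι → Fin n → ℤ)
      (f : (ι → MvPolynomial (Fin n) k) →ₗ[MvPolynomial (Fin n) k] M),
      IsSq (k := k) T (freeDeg (k := k) F) ∧ Function.Surjective f ∧
        IsHomogeneousMap (freeDeg (k := k) F) ℳ 0 f := by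
  have hfin := hM.finite
  have htop := (Submodule.eq_top_iff'.2 hM.mem_span)
  obtain ⟨s, hs, hs'⟩ := Submodule.fg_span_iff_fg_span_finset_subset _ |>.1
    (htop ▸ Module.Finite.fg_top)
  choose F h0 h1 hT hF using hs
  refine ⟨s, inferInstance, fun g => F g.2, Fintype.linearCombination _ (fun g : s => (g : M)),
    isSq_freeDeg (fun g => h0 _) (fun g => h1 _) (fun g => hT _), ?_, fun a v hv => ?_⟩
  · rw [← LinearMap.range_eq_top, Fintype.range_linearCombination, ← htop, hs']
    exact congrArg _ Subtype.range_coe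
  · rw [Fintype.linearCombination_apply, zero_add]
    refine sum_mem fun g _ => ?_
    have := hM.smul_mem _ _ _ (hv g) _ (hF g.2)
    rwa [sub_add_cancel] at this

end Free

end IsSq

/-! ### Squarefree free resolutions -/

section ResolutionOfExact

variable {R : Type u} [CommRing R] {X : ℕ → Type u} [∀ j, AddCommGroup (X j)]
  [∀ j, Module R (X j)] {M : Type u} [AddCommGroup M] [Module R M]

/-- The chain complex with terms `X j` and differentials `d j`. -/
def complexOfMaps (d : ∀ j, X (j + 1) →ₗ[R] X j) (hd : ∀ j, d j ∘ₗ d (j + 1) = 0) :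
    ChainComplex (ModuleCat.{u} R) ℕ :=
  ChainComplex.of (fun j => ModuleCat.of R (X j)) (fun j => ModuleCat.ofHom (d j))
    fun j => by rw [← ModuleCat.ofHom_comp, hd j]; rfl

lemma complexOfMaps_d (d : ∀ j, X (j + 1) →ₗ[R] X j) (hd : ∀ j, d j ∘ₗ d (j + 1) = 0) (j : ℕ) :
    (complexOfMaps d hd).d (j + 1) j = ModuleCat.ofHom (d j) :=
  ChainComplex.of_d (fun j => ModuleCat.of R (X j)) (fun j => ModuleCat.ofHom (d j)) j

lemma complexOfMaps_d_comp (d : ∀ j, X (j + 1) →ₗ[R] X j) (hd : ∀ j, d j ∘ₗ d (j + 1) = 0)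
    (ε : X 0 →ₗ[R] M) (hε : LinearMap.range (d 0) = LinearMap.ker ε) :
    (complexOfMaps d hd).d 1 0 ≫ ModuleCat.ofHom (Y := M) ε = 0 := by
  have h : ε ∘ₗ d 0 = 0 := LinearMap.range_le_ker_iff.1 hε.le
  refine (congrArg (· ≫ ModuleCat.ofHom ε) (complexOfMaps_d d hd 0)).trans ?_
  exact congrArg ModuleCat.ofHom h

lemma exactAt_complexOfMaps (d : ∀ j, X (j + 1) →ₗ[R] X j) (hd : ∀ j, d j ∘ₗ d (j + 1) = 0)
    (j : ℕ) (hj : LinearMap.range (d (j + 1)) = LinearMap.ker (d j)) :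
    (complexOfMaps d hd).ExactAt (j + 1) := by
  rw [HomologicalComplex.exactAt_iff' _ (j + 1 + 1) (j + 1) j (by simp) (by simp),
    ShortComplex.moduleCat_exact_iff_ker_sub_range]
  have h1 := complexOfMaps_d d hd (j + 1)
  have h2 := complexOfMaps_d d hd j
  change LinearMap.ker ((complexOfMaps d hd).d (j + 1) j).hom ≤
    LinearMap.range ((complexOfMaps d hd).d (j + 1 + 1) (j + 1)).hom
  rw [h1, h2]
  exact hj.ge

lemma exact_complexOfMaps_zero (d : ∀ j, X (j + 1) →ₗ[R] X j) (hd : ∀ j, d j ∘ₗ d (j + 1) = 0)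
    (ε : X 0 →ₗ[R] M) (hε : LinearMap.range (d 0) = LinearMap.ker ε) :
    (ShortComplex.mk _ _ (complexOfMaps_d_comp d hd ε hε)).Exact := by
  rw [ShortComplex.moduleCat_exact_iff_ker_sub_range]
  change LinearMap.ker ε ≤ LinearMap.range ((complexOfMaps d hd).d 1 0).hom
  have h1 : (complexOfMaps d hd).d 1 0 = ModuleCat.ofHom (d 0) := complexOfMaps_d d hd 0
  rw [h1]
  exact hε.ge

/-- An exact sequence `⋯ → X 1 → X 0 → M → 0` of linear maps with projective `X j`, as a
projective resolution of `M`. -/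
noncomputable def resolutionOfExact (d : ∀ j, X (j + 1) →ₗ[R] X j)
    (hd : ∀ j, LinearMap.range (d (j + 1)) = LinearMap.ker (d j))
    (ε : X 0 →ₗ[R] M) (hε : LinearMap.range (d 0) = LinearMap.ker ε)
    (hsurj : Function.Surjective ε) (hX : ∀ j, Module.Projective R (X j)) :
    ProjectiveResolution (ModuleCat.of R M) where
  complex := complexOfMaps d fun j => LinearMap.range_le_ker_iff.1 (hd j).le
  projective j := (IsProjective.iff_projective (X j)).1 (hX j)
  π := (ChainComplex.toSingle₀Equiv _ _).symm ⟨ModuleCat.ofHom ε, complexOfMaps_d_comp _ _ _ hε⟩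
  quasiIso := ⟨fun j => by
    cases j with
    | zero =>
      rw [ChainComplex.quasiIsoAt₀_iff, ShortComplex.quasiIso_iff_of_zeros']
      · have hepi : Epi (ModuleCat.ofHom ε) := (ModuleCat.epi_iff_surjective _).2 hsurj
        refine (ShortComplex.exact_and_epi_g_iff_of_iso ?_).2
          ⟨exact_complexOfMaps_zero d (fun j => LinearMap.range_le_ker_iff.1 (hd j).le) ε hε, hepi⟩
        exact ShortComplex.isoMk (Iso.refl _) (Iso.refl _) (Iso.refl _)
          ((Category.id_comp _).trans (Category.comp_id _).symm)
          ((Category.id_comp _).trans (Category.comp_id _).symm)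
      all_goals rfl
    | succ j =>
      rw [quasiIsoAt_iff_exactAt']
      · exact exactAt_complexOfMaps d _ j (hd j)
      · apply ChainComplex.exactAt_succ_single_obj⟩

end ResolutionOfExact

section Resolution

variable (k : Type u) [Field k] {n : ℕ}

/-- A squarefree module, constant in the directions of `T`, with its grading. -/
structure SqMod (T : Set (Fin n)) : Type (u + 1) where
  /-- the underlying type -/
  carrier : Type u
  [addCommGroup : AddCommGroup carrier]
  [module : Module (MvPolynomial (Fin n) k) carrier]
  /-- the grading -/
  deg : (Fin n → ℤ) → AddSubgroup carrier
  isSq : IsSq (k := k) T deg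

attribute [instance] SqMod.addCommGroup SqMod.module

variable {k} {T : Set (Fin n)}

/-- A homogeneous surjection of degree `0` from a projective squarefree module onto `N`. -/
structure SqCover (N : SqMod k T) : Type (u + 1) where
  /-- the projective module -/
  total : SqMod k T
  projective : Module.Projective (MvPolynomial (Fin n) k) total.carrier
  /-- the surjection -/
  map : total.carrier →ₗ[MvPolynomial (Fin n) k] N.carrier
  surjective : Function.Surjective map
  isHomogeneousMap : IsHomogeneousMap total.deg N.deg 0 map

lemma nonempty_sqCover (N : SqMod k T) : Nonempty (SqCover N) := by
  obtain ⟨ι, _, F, f, h, hf, hf'⟩ := N.isSq.exists_free_cover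
  exact ⟨⟨⟨ι → MvPolynomial (Fin n) k, freeDeg F, h⟩, inferInstance, f, hf, hf'⟩⟩

/-- A chosen cover. -/
noncomputable def SqMod.cover (N : SqMod k T) : SqCover N := (nonempty_sqCover N).some

/-- The kernel of the chosen cover. -/
noncomputable def SqMod.syzygy (N : SqMod k T) : SqMod k T where
  carrier := LinearMap.ker N.cover.map
  deg := subDeg N.cover.total.deg (LinearMap.ker N.cover.map)
  isSq := N.cover.total.isSq.ker N.isSq N.cover.isHomogeneousMap

/-- The iterated kernels of the chosen covers. -/
noncomputable def SqMod.syzygies (N : SqMod k T) : ℕ → SqMod k T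
  | 0 => N
  | j + 1 => (SqMod.syzygies N j).syzygy

/-- The `j`-th term of the chosen resolution. -/
noncomputable def SqMod.term (N : SqMod k T) (j : ℕ) : SqMod k T := (N.syzygies j).cover.total

/-- The cover of the next syzygy module, followed by its inclusion. -/
noncomputable def SqMod.diff (N : SqMod k T) (j : ℕ) :
    (N.term (j + 1)).carrier →ₗ[MvPolynomial (Fin n) k] (N.term j).carrier :=
  LinearMap.comp (M₂ := LinearMap.ker (N.syzygies j).cover.map)
    (M₃ := (N.syzygies j).cover.total.carrier)
    (LinearMap.ker (N.syzygies j).cover.map).subtype (N.syzygies (j + 1)).cover.map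

lemma SqMod.range_diff (N : SqMod k T) (j : ℕ) :
    LinearMap.range (N.diff j) = LinearMap.ker (N.syzygies j).cover.map := by
  refine (LinearMap.range_comp_of_range_eq_top
    (LinearMap.ker (N.syzygies j).cover.map).subtype ?_).trans (Submodule.range_subtype _)
  exact LinearMap.range_eq_top.2 (N.syzygies (j + 1)).cover.surjective

lemma SqMod.ker_diff (N : SqMod k T) (j : ℕ) :
    LinearMap.ker (N.diff j) = LinearMap.ker (N.syzygies (j + 1)).cover.map :=
  LinearMap.ker_comp_of_ker_eq_bot _ (Submodule.ker_subtype _)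

lemma SqMod.range_diff_succ (N : SqMod k T) (j : ℕ) :
    LinearMap.range (N.diff (j + 1)) = LinearMap.ker (N.diff j) :=
  (N.range_diff (j + 1)).trans (N.ker_diff j).symm

lemma SqMod.isHomogeneousMap_diff (N : SqMod k T) (j : ℕ) :
    IsHomogeneousMap (N.term (j + 1)).deg (N.term j).deg 0 (N.diff j) := fun b y hy =>
  (N.syzygies (j + 1)).cover.isHomogeneousMap b y hy

/-- The chosen resolution, as a projective resolution. -/
noncomputable def SqMod.resolution (N : SqMod k T) :
    ProjectiveResolution (ModuleCat.of (MvPolynomial (Fin n) k) N.carrier) :=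
  resolutionOfExact (X := fun j => (N.term j).carrier) (fun j => N.diff j)
    N.range_diff_succ N.cover.map (N.range_diff 0)
    N.cover.surjective fun j => (N.syzygies j).cover.projective

/-- The chosen resolution, as a graded resolution. -/
noncomputable def SqMod.gradedResolution (N : SqMod k T) : GradedResolution (k := k) N.deg where
  res := N.resolution
  deg j := (N.term j).deg
  isGrading j := (N.term j).isSq.toIsGrading
  d_mem i j a y hy := by
    by_cases h : j + 1 = i
    · subst h
      have h1 := N.isHomogeneousMap_diff j a y hy
      rw [zero_add] at h1
      have h2 : N.resolution.complex.d (j + 1) j = ModuleCat.ofHom (N.diff j) :=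
        complexOfMaps_d (X := fun j => (N.term j).carrier) (fun j => N.diff j)
          (fun j => LinearMap.range_le_ker_iff.1 (N.range_diff_succ j).le) j
      rw [h2]
      exact h1
    · rw [N.resolution.complex.shape i j (by simpa using h)]
      exact zero_mem _
  π_mem a y hy := by
    have := N.cover.isHomogeneousMap a y hy
    rw [zero_add] at this
    exact this

variable {M : Type u} [AddCommGroup M] [Module (MvPolynomial (Fin n) k) M]
  {ℳ : (Fin n → ℤ) → AddSubgroup M}

/-- Every squarefree module has a graded projective resolution by squarefree modules. -/
lemma IsSq.exists_gradedResolution (hM : IsSq (k := k) T ℳ) :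
    ∃ P : GradedResolution (k := k) ℳ, ∀ j, IsSq (k := k) T (P.deg j) :=
  ⟨SqMod.gradedResolution ⟨M, ℳ, hM⟩, fun j => (SqMod.term ⟨M, ℳ, hM⟩ j).isSq⟩

end Resolution

/-! ### `Ext` through cocycles -/

section Cocycles

variable {R : Type u} [CommRing R] {M N : Type u} [AddCommGroup M] [Module R M] [AddCommGroup N]
  [Module R N]

/-- In all degrees, including degree `0`, a cocycle has trivial class if and only if it factors
through a differential. -/
lemma extMk_eq_zero_iff_exists (P : ProjectiveResolution (ModuleCat.of R M)) {j : ℕ}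
    (f : P.complex.X j ⟶ ModuleCat.of R N) (hf : P.complex.d (j + 1) j ≫ f = 0) :
    P.extMk f (j + 1) rfl hf = 0 ↔
      ∃ (p : ℕ) (g : P.complex.X p ⟶ ModuleCat.of R N), P.complex.d j p ≫ g = f := by
  cases j with
  | zero =>
    have key : P.extMk f (0 + 1) rfl hf = 0 ↔ f = 0 := by
      rw [← P.extEquivCohomologyClass.apply_eq_iff_eq,
        ProjectiveResolution.extEquivCohomologyClass_extMk,
        ProjectiveResolution.extEquivCohomologyClass_zero,
        CochainComplex.HomComplex.CohomologyClass.mk_eq_zero_iff,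
        CochainComplex.HomComplex.Cocycle.toSingleMk_mem_coboundaries_iff _ _ _ _ _ 1 (by simp)]
      constructor
      -- in degree `0` the only coboundary is zero, as the resolution has no term of degree `-1`
      · rintro ⟨g, hg⟩
        have h0 : P.cochainComplex.d (-(0 : ℕ) : ℤ) 1 = 0 := by
          apply Limits.IsZero.eq_of_tgt
          exact P.cochainComplex.isZero_of_isStrictlyLE 0 1 (by simp)
        rw [h0, Limits.zero_comp] at hg
        rw [← cancel_epi (P.cochainComplexXIso (-(0 : ℕ) : ℤ) 0 rfl).hom, Limits.comp_zero]
        exact hg.symm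
      · rintro rfl
        exact ⟨0, by simp⟩
    rw [key]
    constructor
    · rintro rfl
      exact ⟨0, 0, by simp⟩
    · rintro ⟨p, g, rfl⟩
      rw [P.complex.shape 0 p (by simp), Limits.zero_comp]
  | succ j =>
    rw [ProjectiveResolution.extMk_eq_zero_iff _ _ _ _ _ j rfl]
    constructor
    · rintro ⟨g, hg⟩
      exact ⟨j, g, hg⟩
    · rintro ⟨p, g, rfl⟩
      by_cases hp : p = j
      · subst hp
        exact ⟨g, rfl⟩
      · refine ⟨0, ?_⟩
        rw [P.complex.shape (j + 1) p (by simpa using hp), Limits.zero_comp, Limits.comp_zero]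

variable (N) in
/-- The module of cocycles of degree `j` of a resolution with values in `N`. -/
noncomputable def cocycles (P : ProjectiveResolution (ModuleCat.of R M)) (j : ℕ) :
    Submodule R (P.complex.X j →ₗ[R] N) where
  carrier := {f | f ∘ₗ (P.complex.d (j + 1) j).hom = 0}
  add_mem' hf hg := by
    change _ ∘ₗ _ = 0 at hf hg
    change _ ∘ₗ _ = 0
    rw [LinearMap.add_comp, hf, hg, add_zero]
  zero_mem' := LinearMap.zero_comp _
  smul_mem' c f hf := by
    change _ ∘ₗ _ = 0 at hf
    change _ ∘ₗ _ = 0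
    rw [LinearMap.smul_comp, hf, smul_zero]

lemma mem_cocycles {P : ProjectiveResolution (ModuleCat.of R M)} {j : ℕ}
    {f : P.complex.X j →ₗ[R] N} :
    f ∈ cocycles N P j ↔ f ∘ₗ (P.complex.d (j + 1) j).hom = 0 := Iff.rfl

lemma comp_ofHom_eq_zero {P : ProjectiveResolution (ModuleCat.of R M)} {j : ℕ}
    {f : P.complex.X j →ₗ[R] N} (hf : f ∈ cocycles N P j) :
    P.complex.d (j + 1) j ≫ ModuleCat.ofHom f = 0 :=
  ModuleCat.hom_ext hf

variable (N) in
/-- The class of a cocycle, as a linear map. -/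
noncomputable def extClass (P : ProjectiveResolution (ModuleCat.of R M)) (j : ℕ) :
    cocycles N P j →ₗ[R] Abelian.Ext (ModuleCat.of R M) (ModuleCat.of R N) j where
  toFun f := P.extMk (ModuleCat.ofHom f.1) (j + 1) rfl (comp_ofHom_eq_zero f.2)
  map_add' f g := by
    rw [P.add_extMk]
    rfl
  map_smul' r f := by
    rw [RingHom.id_apply, Abelian.Ext.smul_eq_comp_mk₀, P.extMk_comp_mk₀]
    congr 1

variable {P : ProjectiveResolution (ModuleCat.of R M)} {j : ℕ}

lemma extClass_surjective : Function.Surjective (extClass N P j) := fun e => by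
  obtain ⟨f, hf, rfl⟩ := P.extMk_surjective e (j + 1) rfl
  exact ⟨⟨f.hom, congrArg ModuleCat.Hom.hom hf⟩, rfl⟩

lemma extClass_eq_zero_iff {f : cocycles N P j} :
    extClass N P j f = 0 ↔
      ∃ (p : ℕ) (g : P.complex.X p →ₗ[R] N), g ∘ₗ (P.complex.d j p).hom = f := by
  refine (extMk_eq_zero_iff_exists P _ (comp_ofHom_eq_zero f.2)).trans ⟨?_, ?_⟩
  · rintro ⟨p, g, hg⟩
    exact ⟨p, g.hom, congrArg ModuleCat.Hom.hom hg⟩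
  · rintro ⟨p, g, hg⟩
    exact ⟨p, ModuleCat.ofHom g, ModuleCat.hom_ext hg⟩

end Cocycles

/-! ### The grading of `Ext` -/

section Comparison

open MvPolynomial

variable {k : Type u} [Field k] {n : ℕ} {M M' N : Type u} [AddCommGroup M]
  [Module (MvPolynomial (Fin n) k) M] [AddCommGroup M'] [Module (MvPolynomial (Fin n) k) M']
  [AddCommGroup N] [Module (MvPolynomial (Fin n) k) N]
  {ℳ : (Fin n → ℤ) → AddSubgroup M} {ℳ' : (Fin n → ℤ) → AddSubgroup M'}
  {𝒩 : (Fin n → ℤ) → AddSubgroup N}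

/-- The augmentation `P₀ → M` of a graded resolution, as a linear map. -/
noncomputable def GradedResolution.aug (P : GradedResolution (k := k) ℳ) :
    P.res.complex.X 0 →ₗ[MvPolynomial (Fin n) k] M :=
  (P.res.π.f 0 ≫ (HomologicalComplex.singleObjXSelf (ComplexShape.down ℕ) 0
      (ModuleCat.of (MvPolynomial (Fin n) k) M)).hom).hom

lemma GradedResolution.isHomogeneousMap_aug (P : GradedResolution (k := k) ℳ) :
    IsHomogeneousMap (P.deg 0) ℳ 0 P.aug := fun a y hy => by
  rw [zero_add]
  exact P.π_mem a y hy

lemma GradedResolution.isHomogeneousMap_d (P : GradedResolution (k := k) ℳ) (i j : ℕ) :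
    IsHomogeneousMap (P.deg i) (P.deg j) 0 (P.res.complex.d i j).hom := fun a y hy => by
  rw [zero_add]
  exact P.d_mem i j a y hy

/-- Compatibility with the augmentations, in terms of linear maps. -/
lemma hom_f_zero_comp_π_iff (P : GradedResolution (k := k) ℳ) (Q : GradedResolution (k := k) ℳ')
    (ψ : M →ₗ[MvPolynomial (Fin n) k] M') (φ : P.res.complex.X 0 ⟶ Q.res.complex.X 0) :
    φ ≫ Q.res.π.f 0 = P.res.π.f 0 ≫ ((ChainComplex.single₀ _).map (ModuleCat.ofHom ψ)).f 0 ↔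
      Q.aug ∘ₗ φ.hom = ψ ∘ₗ P.aug := by
  rw [← cancel_mono (HomologicalComplex.singleObjXSelf (ComplexShape.down ℕ) 0
      (ModuleCat.of (MvPolynomial (Fin n) k) M')).hom]
  have h : ((ChainComplex.single₀ _).map (ModuleCat.ofHom ψ)).f 0 ≫
      (HomologicalComplex.singleObjXSelf (ComplexShape.down ℕ) 0
      (ModuleCat.of (MvPolynomial (Fin n) k) M')).hom =
      (HomologicalComplex.singleObjXSelf (ComplexShape.down ℕ) 0
      (ModuleCat.of (MvPolynomial (Fin n) k) M)).hom ≫ ModuleCat.ofHom ψ := by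
    rw [← cancel_epi (HomologicalComplex.singleObjXSelf (ComplexShape.down ℕ) 0
      (ModuleCat.of (MvPolynomial (Fin n) k) M)).inv, Iso.inv_hom_id_assoc]
    have := HomologicalComplex.single_map_f_self (ComplexShape.down ℕ) 0 (ModuleCat.ofHom ψ)
    refine (congrArg (fun z => _ ≫ z ≫ _) this).trans ?_
    simp
  rw [Category.assoc, Category.assoc, h]
  constructor
  · intro h'
    exact congrArg ModuleCat.Hom.hom h'
  · intro h'
    exact ModuleCat.hom_ext h'

/-- A homogeneous map lifts to a homogeneous map, of the same degree, of graded resolutions: take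
the components of the right degree of any lift. -/
lemma exists_homogeneous_lift (hM' : IsGrading (k := k) ℳ')
    (P : GradedResolution (k := k) ℳ)
    (Q : GradedResolution (k := k) ℳ') {c : Fin n → ℤ} {ψ : M →ₗ[MvPolynomial (Fin n) k] M'}
    (hψ : IsHomogeneousMap ℳ ℳ' c ψ) :
    ∃ φ : ProjectiveResolution.Hom P.res Q.res (ModuleCat.ofHom ψ),
      ∀ j, IsHomogeneousMap (P.deg j) (Q.deg j) c (φ.hom.f j).hom := by
  let l := ProjectiveResolution.lift (ModuleCat.ofHom ψ) P.res Q.res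
  refine ⟨⟨⟨fun j => ModuleCat.ofHom (homComp (P.isGrading j) (Q.isGrading j) c (l.f j).hom),
    fun i j _ => ?_⟩, ?_⟩,
    fun j => isHomogeneousMap_homComp (P.isGrading j) (Q.isGrading j) c (l.f j).hom⟩
  · apply ModuleCat.hom_ext
    change (Q.res.complex.d i j).hom ∘ₗ homComp (P.isGrading i) (Q.isGrading i) c (l.f i).hom =
      homComp (P.isGrading j) (Q.isGrading j) c (l.f j).hom ∘ₗ (P.res.complex.d i j).hom
    rw [← homComp_comp_left (P.isGrading i) (Q.isGrading i) (Q.isGrading j) c _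
        (Q.isHomogeneousMap_d i j), ← homComp_comp_right (P.isGrading i) (P.isGrading j)
        (Q.isGrading j) c _ (P.isHomogeneousMap_d i j), zero_add, add_zero]
    congr 1
    exact congrArg ModuleCat.Hom.hom (l.comm i j)
  · refine (hom_f_zero_comp_π_iff P Q ψ _).2 ?_
    change Q.aug ∘ₗ homComp (P.isGrading 0) (Q.isGrading 0) c (l.f 0).hom = ψ ∘ₗ P.aug
    have h := (hom_f_zero_comp_π_iff P Q ψ (l.f 0)).1
      (HomologicalComplex.congr_hom
        (ProjectiveResolution.lift_commutes (ModuleCat.ofHom ψ) P.res Q.res) 0)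
    rw [← homComp_comp_left (P.isGrading 0) (Q.isGrading 0) hM' c _ Q.isHomogeneousMap_aug, h,
      zero_add]
    refine homComp_eq_self _ _ fun b y hy => hψ b _ ?_
    have := P.isHomogeneousMap_aug b y hy
    rwa [zero_add] at this

/-- Precomposition with a homogeneous map of degree `c` maps classes of homogeneous cocycles of
degree `a` to classes of homogeneous cocycles of degree `a + c`, with respect to any resolutions. -/
lemma exists_extClass_of_comp (hM' : IsGrading (k := k) ℳ')
    (P : GradedResolution (k := k) ℳ)
    (Q : GradedResolution (k := k) ℳ') {c : Fin n → ℤ} {ψ : M →ₗ[MvPolynomial (Fin n) k] M'}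
    (hψ : IsHomogeneousMap ℳ ℳ' c ψ) {j : ℕ} {a : Fin n → ℤ} (f : cocycles N Q.res j)
    (hf : IsHomogeneousMap (Q.deg j) 𝒩 a f.1) :
    ∃ g : cocycles N P.res j, IsHomogeneousMap (P.deg j) 𝒩 (a + c) g.1 ∧
      extClass N P.res j g =
        (Abelian.Ext.mk₀ (ModuleCat.ofHom ψ)).comp (extClass N Q.res j f) (zero_add j) := by
  obtain ⟨φ, hφ⟩ := exists_homogeneous_lift hM' P Q hψ
  have h := ProjectiveResolution.mk₀_comp_extMk (ModuleCat.ofHom f.1) (j + 1) rfl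
    (comp_ofHom_eq_zero f.2) φ
  refine ⟨⟨f.1 ∘ₗ (φ.hom.f j).hom, ?_⟩, fun b y hy => ?_, h.symm⟩
  · have h1 := congrArg ModuleCat.Hom.hom (φ.hom.comm (j + 1) j)
    have h2 : (φ.hom.f j).hom ∘ₗ (P.res.complex.d (j + 1) j).hom =
      (Q.res.complex.d (j + 1) j).hom ∘ₗ (φ.hom.f (j + 1)).hom := h1.symm
    rw [mem_cocycles, LinearMap.comp_assoc, h2, ← LinearMap.comp_assoc, mem_cocycles.1 f.2,
      LinearMap.zero_comp]
  · rw [add_assoc]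
    exact hf _ _ (hφ j b y hy)

lemma isHomogeneousMap_id : IsHomogeneousMap ℳ ℳ 0
    (LinearMap.id : M →ₗ[MvPolynomial (Fin n) k] M) := fun b y hy => by
  rw [zero_add]
  exact hy

/-- The degree `a` part of `Ext` can be computed with any one graded resolution. -/
lemma mem_extDeg_iff (hM : IsGrading (k := k) ℳ) (P : GradedResolution (k := k) ℳ) {j : ℕ}
    {a : Fin n → ℤ} {e : Abelian.Ext (ModuleCat.of (MvPolynomial (Fin n) k) M)
      (ModuleCat.of (MvPolynomial (Fin n) k) N) j} :
    e ∈ extDeg (k := k) ℳ 𝒩 j a ↔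
      ∃ f : cocycles N P.res j, IsHomogeneousMap (P.deg j) 𝒩 a f.1 ∧ extClass N P.res j f = e := by
  constructor
  · rintro ⟨Q, f, hf, hfa, rfl⟩
    obtain ⟨g, hg, hge⟩ := exists_extClass_of_comp (N := N) hM P Q isHomogeneousMap_id
      (⟨f.hom, congrArg ModuleCat.Hom.hom hf⟩ : cocycles N Q.res j) hfa
    rw [add_zero] at hg
    refine ⟨g, hg, hge.trans ?_⟩
    exact Abelian.Ext.mk₀_id_comp _
  · rintro ⟨f, hf, rfl⟩
    exact ⟨P, ModuleCat.ofHom f.1, comp_ofHom_eq_zero f.2, hf, rfl⟩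

/-- Precomposition with a homogeneous map of degree `c` raises the degree in `Ext` by `c`. -/
lemma comp_mem_extDeg (hM : IsGrading (k := k) ℳ) (hM' : IsGrading (k := k) ℳ')
    (P : GradedResolution (k := k) ℳ) {c : Fin n → ℤ} {ψ : M →ₗ[MvPolynomial (Fin n) k] M'}
    (hψ : IsHomogeneousMap ℳ ℳ' c ψ) {j : ℕ} {a : Fin n → ℤ}
    {e : Abelian.Ext (ModuleCat.of (MvPolynomial (Fin n) k) M')
      (ModuleCat.of (MvPolynomial (Fin n) k) N) j} (he : e ∈ extDeg (k := k) ℳ' 𝒩 j a) :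
    (Abelian.Ext.mk₀ (ModuleCat.ofHom ψ)).comp e (zero_add j) ∈ extDeg (k := k) ℳ 𝒩 j (a + c) := by
  obtain ⟨Q, f, hf, hfa, rfl⟩ := he
  obtain ⟨g, hg, hge⟩ := exists_extClass_of_comp (N := N) hM' P Q hψ
      (⟨f.hom, congrArg ModuleCat.Hom.hom hf⟩ : cocycles N Q.res j) hfa
  exact (mem_extDeg_iff hM P).2 ⟨g, hg, hge⟩

end Comparison

section ExtGrading

open MvPolynomial

variable {k : Type u} [Field k] {n : ℕ} {M N : Type u} [AddCommGroup M]
  [Module (MvPolynomial (Fin n) k) M] [AddCommGroup N] [Module (MvPolynomial (Fin n) k) N]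
  {ℳ : (Fin n → ℤ) → AddSubgroup M} {𝒩 : (Fin n → ℤ) → AddSubgroup N}

variable (𝒩) in
/-- The degree `a` part of `Ext`, as a subgroup. It does not depend on the graded resolution `P`,
which only serves to show that it is closed under addition. -/
def extSubgroup (hM : IsGrading (k := k) ℳ) (P : GradedResolution (k := k) ℳ) (j : ℕ)
    (a : Fin n → ℤ) : AddSubgroup (Abelian.Ext (ModuleCat.of (MvPolynomial (Fin n) k) M)
      (ModuleCat.of (MvPolynomial (Fin n) k) N) j) where
  carrier := extDeg (k := k) ℳ 𝒩 j a
  add_mem' he he' := by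
    obtain ⟨f, hf, rfl⟩ := (mem_extDeg_iff hM P).1 he
    obtain ⟨g, hg, rfl⟩ := (mem_extDeg_iff hM P).1 he'
    rw [← map_add]
    exact (mem_extDeg_iff hM P).2 ⟨f + g, fun b y hy => add_mem (hf b y hy) (hg b y hy), rfl⟩
  zero_mem' := (mem_extDeg_iff hM P).2 ⟨0, fun b y hy => zero_mem _, map_zero _⟩
  neg_mem' he := by
    obtain ⟨f, hf, rfl⟩ := (mem_extDeg_iff hM P).1 he
    rw [← map_neg]
    exact (mem_extDeg_iff hM P).2 ⟨-f, fun b y hy => neg_mem (hf b y hy), rfl⟩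

lemma mem_extSubgroup_iff {hM : IsGrading (k := k) ℳ} {P : GradedResolution (k := k) ℳ} {j : ℕ}
    {a : Fin n → ℤ} {e : Abelian.Ext (ModuleCat.of (MvPolynomial (Fin n) k) M)
      (ModuleCat.of (MvPolynomial (Fin n) k) N) j} :
    e ∈ extSubgroup 𝒩 hM P j a ↔
      ∃ f : cocycles N P.res j, IsHomogeneousMap (P.deg j) 𝒩 a f.1 ∧ extClass N P.res j f = e :=
  mem_extDeg_iff hM P

/-- The components of a cocycle are cocycles. -/
lemma homComp_mem_cocycles (P : GradedResolution (k := k) ℳ) (hN : IsGrading (k := k) 𝒩) {j : ℕ}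
    {f : P.res.complex.X j →ₗ[MvPolynomial (Fin n) k] N} (hf : f ∈ cocycles N P.res j)
    (a : Fin n → ℤ) : homComp (P.isGrading j) hN a f ∈ cocycles N P.res j := by
  rw [mem_cocycles, ← homComp_comp_right (P.isGrading (j + 1)) (P.isGrading j) hN a f
    (P.isHomogeneousMap_d _ _), mem_cocycles.1 hf, homComp_zero]

/-- A homogeneous cocycle which is a coboundary is the coboundary of a homogeneous cochain of the
same degree. -/
lemma exists_homogeneous_of_extClass_eq_zero (P : GradedResolution (k := k) ℳ)
    (hN : IsGrading (k := k) 𝒩) {j : ℕ} {a : Fin n → ℤ} {f : cocycles N P.res j}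
    (hf : IsHomogeneousMap (P.deg j) 𝒩 a f.1) (h : extClass N P.res j f = 0) :
    ∃ (p : ℕ) (g : P.res.complex.X p →ₗ[MvPolynomial (Fin n) k] N),
      IsHomogeneousMap (P.deg p) 𝒩 a g ∧ g ∘ₗ (P.res.complex.d j p).hom = f := by
  obtain ⟨p, g, hg⟩ := extClass_eq_zero_iff.1 h
  refine ⟨p, homComp (P.isGrading p) hN a g, isHomogeneousMap_homComp _ _ _ _, ?_⟩
  rw [← homComp_comp_right (P.isGrading j) (P.isGrading p) hN a g (P.isHomogeneousMap_d _ _), hg,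
    add_zero, homComp_eq_self _ _ hf]

/-- `Ext` is graded when the terms of the resolution are finitely generated. -/
lemma isGrading_extSubgroup (hM : IsGrading (k := k) ℳ) (P : GradedResolution (k := k) ℳ)
    (hN : IsGrading (k := k) 𝒩) (j : ℕ)
    (hP : Module.Finite (MvPolynomial (Fin n) k) (P.res.complex.X j)) :
    IsGrading (k := k) (extSubgroup 𝒩 hM P j) where
  isInternal := by
    refine isInternal_of_sum_eq_zero (fun e => ?_) (fun s e he hs a ha => ?_)
    · obtain ⟨f, rfl⟩ := extClass_surjective (P := P.res) e
      obtain ⟨s, hs⟩ := exists_sum_homComp (P.isGrading j) hN f.1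
      have : f = ∑ a ∈ s, ⟨_, homComp_mem_cocycles P hN f.2 a⟩ := by
        ext1
        rw [AddSubmonoidClass.coe_finsetSum]
        exact hs.symm
      rw [this, map_sum]
      exact sum_mem fun a _ => AddSubgroup.mem_iSup_of_mem a
        (mem_extSubgroup_iff.2
          ⟨_, isHomogeneousMap_homComp (P.isGrading j) hN a f.1, rfl⟩)
    -- if a sum of homogeneous cocycles bounds `g`, the components bound the components of `g`
    · choose f hf hfe using fun a => mem_extSubgroup_iff.1 (he a)
      simp only [← hfe] at hs ⊢
      rw [← map_sum, extClass_eq_zero_iff] at hs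
      obtain ⟨p, g, hg⟩ := hs
      refine extClass_eq_zero_iff.2 ⟨p, homComp (P.isGrading p) hN a g, ?_⟩
      rw [← homComp_comp_right (P.isGrading j) (P.isGrading p) hN a g (P.isHomogeneousMap_d _ _),
        hg, add_zero, AddSubmonoidClass.coe_finsetSum, homComp_sum, Finset.sum_eq_single_of_mem a ha,
        homComp_eq_self _ _ (hf a)]
      exact fun b _ hb => homComp_eq_zero _ _ hb (hf b)
  smul_mem a b s hs e he := by
    obtain ⟨f, hf, rfl⟩ := mem_extSubgroup_iff.1 he
    rw [← map_smul]
    refine mem_extSubgroup_iff.2 ⟨s • f, fun c y hy => ?_, rfl⟩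
    rw [add_assoc]
    exact hN.smul_mem _ _ _ hs _ (hf c y hy)

/-! ### Homogeneous maps from a squarefree module to the canonical module -/

variable {T : Set (Fin n)}

/-- There are no homogeneous maps of degree `a` from a squarefree module to the canonical module
if `aᵢ < 0`, or if `aᵢ ≤ 0` and `i ∈ T`. -/
lemma IsSq.homogeneousMap_eq_zero (hM : IsSq (k := k) T ℳ) {a : Fin n → ℤ} {i : Fin n}
    (ha : a i < 0 ∨ a i ≤ 0 ∧ i ∈ T) {f : M →ₗ[MvPolynomial (Fin n) k] MvPolynomial (Fin n) k}
    (hf : IsHomogeneousMap ℳ (canonicalDeg k) a f) : f = 0 := by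
  refine LinearMap.ext_on (Submodule.eq_top_iff'.2 hM.mem_span) ?_
  rintro y ⟨F, hF0, hF1, hFT, hy⟩
  refine eq_zero_of_mem_polyDeg (fun h => ?_) (hf F y hy)
  have h1 := h i
  have h2 := hF1 i
  simp only [Pi.zero_apply, Pi.add_apply, Pi.sub_apply, Pi.one_apply] at h1
  rcases ha with ha | ⟨ha, hi⟩
  · omega
  · rw [hFT i hi] at h1
    omega

/-- A homogeneous map from a squarefree module to the canonical module whose `i`-th degree is
at least `2` is divisible by `xᵢ`. -/
lemma IsSq.exists_X_smul_eq (hM : IsSq (k := k) T ℳ) {a : Fin n → ℤ} {i : Fin n} (ha : 1 ≤ a i)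
    {f : M →ₗ[MvPolynomial (Fin n) k] MvPolynomial (Fin n) k}
    (hf : IsHomogeneousMap ℳ (canonicalDeg k) (a + Pi.single i 1) f) :
    ∃ h : M →ₗ[MvPolynomial (Fin n) k] MvPolynomial (Fin n) k,
      IsHomogeneousMap ℳ (canonicalDeg k) a h ∧ (X i : MvPolynomial (Fin n) k) • h = f := by
  have hdvd (y : M) : X i ∣ f y := by
    have hle : Submodule.span (MvPolynomial (Fin n) k)
        {g : M | ∃ F : Fin n → ℤ, 0 ≤ F ∧ (∀ i, F i ≤ 1) ∧ (∀ i ∈ T, F i = 0) ∧ g ∈ ℳ F} ≤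
        Submodule.comap f (Ideal.span {(X i : MvPolynomial (Fin n) k)}) := by
      rw [Submodule.span_le]
      rintro y ⟨F, hF0, hF1, hFT, hy⟩
      refine Ideal.mem_span_singleton.2 (X_dvd_of_mem_polyDeg ?_ (hf F y hy))
      have h1 := hF0 i
      simp only [Pi.zero_apply, Pi.add_apply, Pi.sub_apply, Pi.one_apply, Pi.single_eq_same] at *
      omega
    exact Ideal.mem_span_singleton.1 (hle (hM.mem_span y))
  choose h hh using hdvd
  refine ⟨⟨⟨h, fun y z => eq_of_X_mul_eq (i := i) ?_⟩, fun s y => eq_of_X_mul_eq (i := i) ?_⟩,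
    fun b y hy => ?_, LinearMap.ext fun y => (hh y).symm⟩
  · rw [mul_add, ← hh, ← hh, ← hh, map_add]
  · rw [← hh, map_smul, RingHom.id_apply, smul_eq_mul, smul_eq_mul, mul_left_comm, ← hh]
  · have := hf b y hy
    rw [hh y] at this
    refine mem_polyDeg_of_X_mul_mem (i := i) ?_
    change X i * h y ∈ polyDeg k (a + b - 1 + Pi.single i 1)
    have hab : a + b - 1 + Pi.single i 1 = a + Pi.single i 1 + b - 1 := by abel
    rw [hab]
    exact this

/-! ### `Ext` into the canonical module is squarefree -/

lemma X_smul_linearMap_injective (i : Fin n) {f g : M →ₗ[MvPolynomial (Fin n) k]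
    MvPolynomial (Fin n) k} (h : (X i : MvPolynomial (Fin n) k) • f =
      (X i : MvPolynomial (Fin n) k) • g) : f = g := by
  ext1 y
  exact eq_of_X_mul_eq (LinearMap.congr_fun h y)

/-- `Ext^j(M, ω)` is squarefree if `M` is squarefree: by divisibility, multiplication by `xᵢ` is
bijective on homogeneous cochains of positive `i`-th degree. -/
lemma isSq_extSubgroup (hM : IsSq (k := k) T ℳ) (P : GradedResolution (k := k) ℳ)
    (hP : ∀ j, IsSq (k := k) T (P.deg j)) (j : ℕ) :
    IsSq (k := k) ∅ (extSubgroup (canonicalDeg k) hM.toIsGrading P j) where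
  toIsGrading := isGrading_extSubgroup hM.toIsGrading P isGrading_canonicalDeg j (hP j).finite
  finite := by
    have := hM.finite
    infer_instance
  eq_bot a ha := by
    rw [eq_bot_iff]
    intro e he
    obtain ⟨f, hf, rfl⟩ := mem_extSubgroup_iff.1 he
    rw [Pi.le_def] at ha
    push Not at ha
    obtain ⟨i, hi⟩ := ha
    have : f = 0 := Subtype.ext ((hP j).homogeneousMap_eq_zero (Or.inl hi) hf)
    rw [this, map_zero]
    exact zero_mem _
  bijOn a i ha hi := by
    have hgr := isGrading_extSubgroup hM.toIsGrading P isGrading_canonicalDeg j (hP j).finite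
    simp only [Set.mem_empty_iff_false, or_false] at hi
    refine ⟨fun e he => hgr.X_smul_mem i he, fun e he e' he' h => ?_, fun e he => ?_⟩
    · rw [← sub_eq_zero]
      have h' : (X i : MvPolynomial (Fin n) k) • (e - e') = 0 := by
        rw [smul_sub, sub_eq_zero]
        exact h
      obtain ⟨f, hf, hfe⟩ := mem_extSubgroup_iff.1 (sub_mem he he')
      rw [← hfe, ← map_smul] at h'
      have hXf : IsHomogeneousMap (P.deg j) (canonicalDeg k) (a + Pi.single i 1)
          ((X i : MvPolynomial (Fin n) k) • f : cocycles _ P.res j).1 := fun b y hy => by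
        rw [add_right_comm]
        exact isGrading_canonicalDeg.X_smul_mem i (hf b y hy)
      obtain ⟨p, g, hg, hgf⟩ :=
        exists_homogeneous_of_extClass_eq_zero P isGrading_canonicalDeg hXf h'
      obtain ⟨g', hg', rfl⟩ := (hP p).exists_X_smul_eq hi hg
      rw [← hfe]
      refine extClass_eq_zero_iff.2 ⟨p, g', X_smul_linearMap_injective i ?_⟩
      rw [← LinearMap.smul_comp, hgf]
      rfl
    · obtain ⟨f, hf, rfl⟩ := mem_extSubgroup_iff.1 he
      obtain ⟨h, hh, hhf⟩ := (hP j).exists_X_smul_eq hi hf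
      have hc : h ∈ cocycles (MvPolynomial (Fin n) k) P.res j := by
        refine mem_cocycles.2 (X_smul_linearMap_injective i ?_)
        rw [← LinearMap.smul_comp, hhf, mem_cocycles.1 f.2, smul_zero]
      refine ⟨extClass _ P.res j ⟨h, hc⟩, mem_extSubgroup_iff.2 ⟨_, hh, rfl⟩, ?_⟩
      change (X i : MvPolynomial (Fin n) k) • extClass _ P.res j ⟨h, hc⟩ = _
      rw [← map_smul]
      exact congrArg _ (Subtype.ext hhf)

/-- If `M` is constant in the direction `i`, then `Ext^j(M, ω)` vanishes in degrees `a` with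
`aᵢ ≤ 0`. -/
lemma eq_zero_of_mem_extSubgroup (hM : IsSq (k := k) T ℳ) (P : GradedResolution (k := k) ℳ)
    (hP : ∀ j, IsSq (k := k) T (P.deg j)) {j : ℕ} {a : Fin n → ℤ} {i : Fin n} (hi : i ∈ T)
    (ha : a i ≤ 0) {e : Abelian.Ext (ModuleCat.of (MvPolynomial (Fin n) k) M)
      (ModuleCat.of (MvPolynomial (Fin n) k) (MvPolynomial (Fin n) k)) j}
    (he : e ∈ extSubgroup (canonicalDeg k) hM.toIsGrading P j a) : e = 0 := by
  obtain ⟨f, hf, rfl⟩ := mem_extSubgroup_iff.1 he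
  have : f = 0 := Subtype.ext ((hP j).homogeneousMap_eq_zero (Or.inr ⟨ha, hi⟩) hf)
  rw [this, map_zero]

end ExtGrading

/-! ### Vanishing of `Ext` near a maximal ideal, and regular sequences -/

section Depth

open RingTheory.Sequence Abelian

variable {R : Type u} [CommRing R]

/-- `E` is annihilated by an element of `1 + I`. When `I` is a maximal ideal and `E` is finitely
generated, this says that the localization of `E` at `I` vanishes. -/
def VanishesNear (I : Ideal R) (E : Type v) [AddCommGroup E] [Module R E] : Prop :=
  ∃ s : R, s - 1 ∈ I ∧ ∀ e : E, s • e = 0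

lemma mul_sub_one_mem {I : Ideal R} {s t : R} (hs : s - 1 ∈ I) (ht : t - 1 ∈ I) :
    s * t - 1 ∈ I := by
  have : s * t - 1 = (s - 1) * t + (t - 1) := by ring
  rw [this]
  exact add_mem (I.mul_mem_right _ hs) ht

lemma VanishesNear.of_subsingleton (I : Ideal R) (E : Type v) [AddCommGroup E] [Module R E]
    [Subsingleton E] : VanishesNear I E :=
  ⟨1, by simp, fun _ => Subsingleton.elim _ _⟩

/-- Nakayama's lemma: `E` vanishes near `I` if multiplication by some element of `I` is surjective
up to an element of `1 + I`. -/
lemma VanishesNear.of_forall_exists {I : Ideal R} {E : Type v} [AddCommGroup E] [Module R E]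
    [Module.Finite R E] {s : R} (hs : s - 1 ∈ I) {r : R} (hr : r ∈ I)
    (h : ∀ e : E, ∃ e' : E, r • e' = s • e) : VanishesNear I E := by
  obtain ⟨t, ht, ht'⟩ := Submodule.exists_sub_one_mem_and_smul_eq_zero_of_fg_of_le_smul I
    (⊤ : Submodule R E) Module.Finite.fg_top fun e _ => by
      obtain ⟨e', he'⟩ := h e
      have : e = r • e' - (s - 1) • e := by rw [he', sub_smul, one_smul]; abel
      rw [this]
      exact sub_mem (Submodule.smul_mem_smul hr trivial) (Submodule.smul_mem_smul hs trivial)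
  exact ⟨t, ht, fun e => ht' e trivial⟩

/-- The length of a regular sequence is at most the Krull dimension. -/
lemma length_le_supportDim {rs : List R} {X : Type u} [AddCommGroup X] [Module R X]
    [Module.Finite R X] (hrs : IsRegular X rs) :
    (rs.length : WithBot ℕ∞) ≤ Module.supportDim R X := by
  induction rs generalizing X with
  | nil =>
    have := hrs.nontrivial
    obtain ⟨a, ha⟩ := WithBot.ne_bot_iff_exists.1 (Module.supportDim_ne_bot_of_nontrivial R X)
    rw [← ha]
    exact WithBot.coe_le_coe.2 zero_le
  | cons x rs ih =>
    obtain ⟨hx, hrs⟩ := (isRegular_cons_iff X x rs).1 hrs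
    rw [List.length_cons, Nat.cast_add, Nat.cast_one]
    refine le_trans (add_le_add_left (ih hrs) 1) ?_
    exact Module.supportDim_quotSMulTop_succ_le_of_notMem_minimalPrimes
      fun p hp => IsSMulRegular.notMem_of_mem_minimalPrimes hx hp

variable {m : Ideal R} {N : ModuleCat.{u} R} {j : ℕ}

/-- An element which annihilates `X` annihilates `Ext^j(X, N)`. -/
lemma smul_ext_eq_zero {X : ModuleCat.{u} R} {s : R} (hs : ∀ x : X, s • x = 0) (e : Ext X N j) :
    s • e = 0 := by
  have h : s • 𝟙 X = 0 := by
    ext x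
    exact hs x
  rw [← Ext.mk₀_id_comp e, ← Ext.smul_comp, ← Ext.mk₀_smul, h, Ext.mk₀_zero, Ext.zero_comp]

lemma not_vanishesNear_ext_zero (hm : m ≠ ⊤) :
    ¬ VanishesNear m (Ext (ModuleCat.of R R) (ModuleCat.of R R) 0) := by
  rintro ⟨s, hs, H⟩
  refine hm (m.eq_top_iff_one.2 ?_)
  have h0 := H (Ext.mk₀ (𝟙 _))
  rw [← Ext.mk₀_smul, ← Ext.mk₀_zero, (Ext.mk₀_bijective _ _).1.eq_iff] at h0
  have h1 : s * (1 : R) = 0 := congrArg (fun f => (ModuleCat.Hom.hom f) (1 : R)) h0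
  rw [mul_one] at h1
  rw [h1, zero_sub, neg_mem_iff] at hs
  exact hs

lemma VanishesNear.ext_of_iso {X Y : ModuleCat.{u} R} (f : X ≅ Y)
    (h : VanishesNear m (Ext X N j)) : VanishesNear m (Ext Y N j) := by
  obtain ⟨s, hs, h⟩ := h
  refine ⟨s, hs, fun e => ?_⟩
  have h1 := h ((Ext.mk₀ f.hom).comp e (zero_add j))
  have h2 : e = (Ext.mk₀ f.inv).comp ((Ext.mk₀ f.hom).comp e (zero_add j)) (zero_add j) := by
    rw [Ext.mk₀_comp_mk₀_assoc, f.inv_hom_id, Ext.mk₀_id_comp]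
  rw [h2, ← Ext.comp_smul, h1, Ext.comp_zero]

variable {S : ShortComplex (ModuleCat.{u} R)}

lemma VanishesNear.ext_X₂ (hS : S.ShortExact) (h₁ : VanishesNear m (Ext S.X₁ N j))
    (h₃ : VanishesNear m (Ext S.X₃ N j)) : VanishesNear m (Ext S.X₂ N j) := by
  obtain ⟨s, hs, h₁⟩ := h₁
  obtain ⟨t, ht, h₃⟩ := h₃
  refine ⟨t * s, mul_sub_one_mem ht hs, fun e => ?_⟩
  obtain ⟨x, hx⟩ := Ext.contravariant_sequence_exact₂ hS N (s • e) (by rw [Ext.comp_smul, h₁])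
  rw [mul_smul, ← hx, ← Ext.comp_smul, h₃, Ext.comp_zero]

/-- If `Ext^{j+1}(X₃, N)` vanishes near `m`, then `Ext^j(X₂, N) → Ext^j(X₁, N)` is surjective up to an
element of `1 + m`. -/
lemma exists_smul_eq_comp (hS : S.ShortExact) (h₃ : VanishesNear m (Ext S.X₃ N (j + 1))) :
    ∃ s : R, s - 1 ∈ m ∧ ∀ e : Ext S.X₁ N j, ∃ x : Ext S.X₂ N j,
      (Ext.mk₀ S.f).comp x (zero_add j) = s • e := by
  obtain ⟨s, hs, h₃⟩ := h₃
  exact ⟨s, hs, fun e => Ext.contravariant_sequence_exact₁ hS N (s • e) (add_comm 1 j)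
    (by rw [Ext.comp_smul, h₃])⟩

lemma VanishesNear.ext_X₁ (hS : S.ShortExact) (h₂ : VanishesNear m (Ext S.X₂ N j))
    (h₃ : VanishesNear m (Ext S.X₃ N (j + 1))) : VanishesNear m (Ext S.X₁ N j) := by
  obtain ⟨s, hs, h₂⟩ := h₂
  obtain ⟨t, ht, h₃⟩ := exists_smul_eq_comp hS h₃
  refine ⟨s * t, mul_sub_one_mem hs ht, fun e => ?_⟩
  obtain ⟨x, hx⟩ := h₃ e
  rw [mul_smul, ← hx, ← Ext.comp_smul, h₂, Ext.comp_zero]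

lemma VanishesNear.ext_X₃ (hS : S.ShortExact) (h₂ : VanishesNear m (Ext S.X₂ N (j + 1)))
    (h₁ : VanishesNear m (Ext S.X₁ N j)) : VanishesNear m (Ext S.X₃ N (j + 1)) := by
  obtain ⟨s, hs, h₁⟩ := h₁
  obtain ⟨t, ht, h₂⟩ := h₂
  refine ⟨s * t, mul_sub_one_mem hs ht, fun e => ?_⟩
  obtain ⟨x, hx⟩ := Ext.contravariant_sequence_exact₃ hS N (t • e)
    (by rw [Ext.comp_smul, h₂]) (add_comm 1 j)
  rw [mul_smul, ← hx, ← Ext.comp_smul, h₁, Ext.comp_zero]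

lemma VanishesNear.ext_X₃_zero (hS : S.ShortExact) (h₂ : VanishesNear m (Ext S.X₂ N 0)) :
    VanishesNear m (Ext S.X₃ N 0) := by
  obtain ⟨s, hs, h₂⟩ := h₂
  refine ⟨s, hs, fun e => ?_⟩
  have := hS.epi_g
  refine Ext.precomp_mk₀_injective_of_epi N S.g ?_
  rw [map_zero]
  change (Ext.mk₀ S.g).comp (s • e) (zero_add 0) = 0
  rw [Ext.comp_smul, h₂]

variable [IsNoetherianRing R]

/-- If every element of the maximal ideal `m` is a zero divisor on `X`, then `R ⧸ m` embeds into
`X`. -/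
lemma exists_injective_of_not_isSMulRegular [hm : m.IsMaximal] (X : Type u) [AddCommGroup X]
    [Module R X] [Module.Finite R X] (h : ∀ x ∈ m, ¬ IsSMulRegular X x) :
    ∃ f : R ⧸ m →ₗ[R] X, Function.Injective f := by
  have hsub : (m : Set R) ⊆ ⋃ p ∈ associatedPrimes R X, (id p : Ideal R) := by
    intro x hx
    have := biUnion_associatedPrimes_eq_compl_regular R X
    simp only [id]
    rw [this]
    exact h x hx
  obtain ⟨p, hp, hmp⟩ := (Ideal.subset_union_prime_finite (associatedPrimes.finite R X)
    (f := id) 0 0 (fun p hp _ _ => IsAssociatedPrime.isPrime hp)).1 hsub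
  obtain rfl : m = p := hm.eq_of_le (IsAssociatedPrime.isPrime hp).ne_top hmp
  obtain ⟨-, x, hx⟩ := isAssociatedPrime_iff.1 hp
  refine ⟨Submodule.liftQ m (LinearMap.toSpanSingleton R X x) ?_, ?_⟩
  · intro r hr
    rw [hx, Submodule.mem_colon_singleton] at hr
    exact hr
  · refine LinearMap.ker_eq_bot.1 (Submodule.ker_liftQ_eq_bot _ _ _ fun r hr => ?_)
    rw [hx, Submodule.mem_colon_singleton]
    exact hr

/-- Conversely to `IsWeaklyRegular.vanishesNear_ext`, vanishing of `Ext^j(X, N)` near `m` for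
`j > n - t` produces a regular sequence of length `t`, if moreover `Ext^n(R ⧸ m, N)` does not vanish
near `m`. -/
theorem exists_isWeaklyRegular_of_vanishesNear_ext [hm : m.IsMaximal] {n : ℕ}
    (hn : ∀ (X : Type u) [AddCommGroup X] [Module R X] [Module.Finite R X] (j : ℕ), n < j →
      VanishesNear m (Ext (ModuleCat.of R X) N j))
    (hn' : ¬ VanishesNear m (Ext (ModuleCat.of R (R ⧸ m)) N n)) (t : ℕ) (X : Type u)
    [AddCommGroup X] [Module R X] [Module.Finite R X]
    (h : ∀ j, n < j + t → VanishesNear m (Ext (ModuleCat.of R X) N j)) :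
    ∃ rs : List R, rs.length = t ∧ (∀ r ∈ rs, r ∈ m) ∧ IsWeaklyRegular X rs := by
  induction t generalizing X with
  | zero => exact ⟨[], rfl, by simp, .nil R X⟩
  | succ t ih =>
    obtain ⟨x, hxm, hx⟩ : ∃ x ∈ m, IsSMulRegular X x := by
      by_contra! H
      obtain ⟨f, hf⟩ := exists_injective_of_not_isSMulRegular X H
      have hS := ModuleCat.shortComplex_shortExact
        (ModuleCat.shortComplexOfCompEqZero f (LinearMap.range f).mkQ
          f.exact_map_mkQ_range.linearMap_comp_eq_zero) f.exact_map_mkQ_range hf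
          (Submodule.mkQ_surjective _)
      -- `R ⧸ m` embeds into `X`, so its `Ext^n` vanishes near `m` together with that of `X`
      exact hn' (.ext_X₁ hS (h n (by omega)) (hn _ _ (by omega)))
    have hS := IsSMulRegular.smulShortComplex_shortExact (M := ModuleCat.of R X) hx
    obtain ⟨rs, hl, hmem, hrs⟩ := ih (QuotSMulTop x X) fun j hj => by
      cases j with
      | zero => exact .ext_X₃_zero hS (h 0 (by omega))
      | succ j => exact .ext_X₃ hS (h _ (by omega)) (h _ (by omega))
    exact ⟨x :: rs, by simp [hl], by simpa using ⟨hxm, hmem⟩, .cons hx hrs⟩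

variable [Module.Finite R N]

/-- If `Ext^{j+1}(X/xX, N)` vanishes near `m`, multiplication by `x` is locally surjective on
`Ext^j(X, N)`. -/
lemma VanishesNear.ext_of_quotSMulTop {X : Type u} [AddCommGroup X] [Module R X]
    [Module.Finite R X] {x : R} (hx : x ∈ m) (hreg : IsSMulRegular X x)
    (h : VanishesNear m (Ext (ModuleCat.of R (QuotSMulTop x X)) N (j + 1))) :
    VanishesNear m (Ext (ModuleCat.of R X) N j) := by
  have hS := IsSMulRegular.smulShortComplex_shortExact (M := ModuleCat.of R X) hreg
  obtain ⟨s, hs, h⟩ := exists_smul_eq_comp hS h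
  refine .of_forall_exists hs hx fun e => ?_
  obtain ⟨y, hy⟩ : ∃ y : Ext (ModuleCat.of R X) N j,
    (Ext.mk₀ (x • 𝟙 (ModuleCat.of R X))).comp y (zero_add j) = s • e := h e
  refine ⟨y, ?_⟩
  rw [← hy, Ext.mk₀_smul, Ext.smul_comp, Ext.mk₀_id_comp]

/-- If `Ext^j(R ⧸ m, N)` vanishes near `m` for all `j > n`, so does `Ext^j(X, N)` for all finitely
generated modules `X`. By Noetherian induction on an ideal `I` annihilating `X`, and by filtering,
one may assume `X = R ⧸ p` with `p` prime. If `p` is properly contained in `m`, any `r ∈ m \ p` is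
regular on `X`, and `X ⧸ rX` is annihilated by the larger ideal `I + (r)`. -/
theorem vanishesNear_ext_of_residue [hm : m.IsMaximal] {n : ℕ}
    (h : ∀ j, n < j → VanishesNear m (Ext (ModuleCat.of R (R ⧸ m)) N j))
    (X : Type u) [AddCommGroup X] [Module R X] [Module.Finite R X] (hj : n < j) :
    VanishesNear m (Ext (ModuleCat.of R X) N j) := by
  suffices H : ∀ (I : Ideal R) (X : Type u) [AddCommGroup X] [Module R X] [Module.Finite R X],
      (∀ r ∈ I, ∀ x : X, r • x = 0) → ∀ j, n < j → VanishesNear m (Ext (ModuleCat.of R X) N j) from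
    H ⊥ X (fun r hr x => by rw [Ideal.mem_bot.1 hr, zero_smul]) j hj
  intro I
  induction I using WellFoundedGT.induction with
  | _ I ih =>
  intro X _ _ hX hI
  induction hX using IsNoetherianRing.induction_on_isQuotientEquivQuotientPrime R with
  | subsingleton X =>
    intro j hj
    refine ⟨1, by simp, smul_ext_eq_zero fun x => ?_⟩
    rw [Subsingleton.elim x 0, smul_zero]
  | exact X₁ X₂ X₃ f g hf hg hfg h₁ h₃ =>
    intro j hj
    have hS := ModuleCat.shortComplex_shortExact
      (ModuleCat.shortComplexOfCompEqZero f g hfg.linearMap_comp_eq_zero) hfg hf hg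
    refine .ext_X₂ hS (h₁ (fun r hr x => hf ?_) j hj) (h₃ (fun r hr x => ?_) j hj)
    · rw [map_smul, hI r hr, map_zero]
    · obtain ⟨y, rfl⟩ := hg x
      rw [← map_smul, hI r hr, map_zero]
  | quotient X p e =>
    intro j hj
    have hp : ∀ r ∈ p.1, ∀ x : X, r • x = 0 := fun r hr x => by
      refine e.injective ?_
      obtain ⟨y, hy⟩ := Ideal.Quotient.mk_surjective (e x)
      rw [map_smul, map_zero, ← hy, Algebra.smul_def, Ideal.Quotient.algebraMap_eq,
        Ideal.Quotient.eq_zero_iff_mem.2 hr, zero_mul]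
    have hIp : I ≤ p.1 := fun r hr => by
      have := congrArg e (hI r hr (e.symm 1))
      rw [map_smul, map_zero, e.apply_symm_apply, Algebra.smul_def, mul_one] at this
      exact Ideal.Quotient.eq_zero_iff_mem.1 this
    by_cases hpm : p.1 ≤ m
    · by_cases hmp : m ≤ p.1
      · obtain ⟨p, hp'⟩ := p
        obtain rfl : p = m := le_antisymm hpm hmp
        exact (h j hj).ext_of_iso e.symm.toModuleIso
      · obtain ⟨r, hrm, hrp⟩ := SetLike.not_le_iff_exists.1 hmp
        have hreg : IsSMulRegular X r := by
          rw [isSMulRegular_iff_right_eq_zero_of_smul]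
          intro x hx
          refine e.injective ?_
          obtain ⟨y, hy⟩ := Ideal.Quotient.mk_surjective (e x)
          have := congrArg e hx
          rw [map_smul, map_zero, ← hy, Algebra.smul_def, Ideal.Quotient.algebraMap_eq, ← map_mul,
            Ideal.Quotient.eq_zero_iff_mem] at this
          rw [← hy, map_zero, Ideal.Quotient.eq_zero_iff_mem]
          exact (p.2.mem_or_mem this).resolve_left hrp
        refine .ext_of_quotSMulTop hrm hreg
          (ih (I ⊔ Ideal.span {r}) ?_ (QuotSMulTop r X) ?_ (j + 1) (by omega))
        · refine lt_of_le_of_ne le_sup_left fun hr => hrp (hIp ?_)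
          rw [hr]
          exact Ideal.mem_sup_right (Ideal.mem_span_singleton_self r)
        · intro s hs x
          obtain ⟨a, ha, b, hb, rfl⟩ := Submodule.mem_sup.1 hs
          obtain ⟨c, rfl⟩ := Ideal.mem_span_singleton'.1 hb
          obtain ⟨x, rfl⟩ := Submodule.mkQ_surjective _ x
          rw [← map_smul, add_smul, hI a ha, zero_add, mul_comm, mul_smul]
          exact (Submodule.Quotient.mk_eq_zero _).2
            (Submodule.smul_mem_pointwise_smul _ _ _ trivial)
    -- otherwise `p` contains an element of `1 + m`
    · have hpm' : p.1 ⊔ m = ⊤ := by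
        rw [sup_comm]
        exact hm.out.2 _ (left_lt_sup.2 hpm)
      obtain ⟨a, ha, b, hb, hab⟩ := Submodule.mem_sup.1 ((Ideal.eq_top_iff_one _).1 hpm')
      refine ⟨a, ?_, smul_ext_eq_zero fun x => hp a ha x⟩
      have : a - 1 = -b := by rw [← hab]; ring
      rw [this]
      exact neg_mem hb

/-- Dividing out a regular sequence raises the top nonvanishing degree of `Ext(-, N)` by its
length. -/
lemma ext_quotient_of_isWeaklyRegular {rs : List R} (hm : ∀ r ∈ rs, r ∈ m) {t : ℕ} (X : Type u)
    [AddCommGroup X] [Module R X] [Module.Finite R X] (hrs : IsWeaklyRegular X rs)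
    (h : ∀ j, t < j → VanishesNear m (Ext (ModuleCat.of R X) N j))
    (h' : ¬ VanishesNear m (Ext (ModuleCat.of R X) N t)) :
    (∀ j, t + rs.length < j → VanishesNear m
      (Ext (ModuleCat.of R (X ⧸ (Ideal.ofList rs • ⊤ : Submodule R X))) N j)) ∧
    ¬ VanishesNear m
      (Ext (ModuleCat.of R (X ⧸ (Ideal.ofList rs • ⊤ : Submodule R X))) N (t + rs.length)) := by
  induction rs generalizing X t with
  | nil =>
    have e : (X ⧸ (Ideal.ofList [] • ⊤ : Submodule R X)) ≃ₗ[R] X :=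
      Submodule.quotEquivOfEqBot _ ((congrArg (· • ⊤) Ideal.ofList_nil).trans (Submodule.bot_smul ⊤))
    exact ⟨fun j hj => (h j hj).ext_of_iso e.symm.toModuleIso,
      fun H => h' (H.ext_of_iso e.toModuleIso)⟩
  | cons x rs ih =>
    obtain ⟨hx, hrs⟩ := (isWeaklyRegular_cons_iff X x rs).1 hrs
    have hS := IsSMulRegular.smulShortComplex_shortExact (M := ModuleCat.of R X) hx
    obtain ⟨h1, h2⟩ := ih (t := t + 1) (fun r hr => hm r (List.mem_cons_of_mem _ hr))
      (QuotSMulTop x X) hrs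
      (fun j hj => by
        obtain ⟨j, rfl⟩ : ∃ i, j = i + 1 := ⟨j - 1, by omega⟩
        exact .ext_X₃ hS (h _ (by omega)) (h _ (by omega)))
      (fun H => h' (.ext_of_quotSMulTop (hm x List.mem_cons_self) hx H))
    have e := Submodule.quotOfListConsSMulTopEquivQuotSMulTopInner X x rs
    have hl : t + (x :: rs).length = t + 1 + rs.length := by
      rw [List.length_cons]; omega
    rw [hl]
    exact ⟨fun j hj => (h1 j hj).ext_of_iso e.symm.toModuleIso,
      fun H => h2 (H.ext_of_iso e.toModuleIso)⟩

/-- If the maximal ideal `m` is generated by a regular sequence of length `n`, the localization of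
`Ext^j(R ⧸ m, R)` at `m` vanishes for `j > n`, but not for `j = n`. -/
lemma vanishesNear_ext_residue {rs : List R} {n : ℕ} (hl : rs.length = n) (hm : m ≠ ⊤)
    (hrs : IsWeaklyRegular R rs) (h : Ideal.ofList rs = m) :
    (∀ j, n < j →
      VanishesNear m (Ext (ModuleCat.of R (R ⧸ m)) (ModuleCat.of R R) j)) ∧
    ¬ VanishesNear m (Ext (ModuleCat.of R (R ⧸ m)) (ModuleCat.of R R) n) := by
  subst hl
  have hmem : ∀ r ∈ rs, r ∈ m := fun r hr => h ▸ Ideal.subset_span hr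
  obtain ⟨h1, h2⟩ := ext_quotient_of_isWeaklyRegular (N := ModuleCat.of R R) (t := 0) hmem R hrs
    (fun j hj => by
      obtain ⟨j, rfl⟩ : ∃ i, j = i + 1 := ⟨j - 1, by omega⟩
      have := Ext.subsingleton_of_projective (ModuleCat.of R R) (ModuleCat.of R R) j
      exact .of_subsingleton _ _)
    (not_vanishesNear_ext_zero hm)
  rw [zero_add] at h1 h2
  have e : (R ⧸ (Ideal.ofList rs • ⊤ : Submodule R R)) ≃ₗ[R] R ⧸ m :=
    Submodule.quotEquivOfEq _ _ (by rw [h]; exact Ideal.mul_top m)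
  exact ⟨fun j hj => (h1 j hj).ext_of_iso e.toModuleIso,
    fun H => h2 (H.ext_of_iso e.symm.toModuleIso)⟩

/-- A regular sequence of length `t` on `X` forces `Ext^j(X, N)` to vanish near `m` for
`j > n - t`, if `n` bounds the nonvanishing degrees for all finitely generated modules. -/
theorem IsWeaklyRegular.vanishesNear_ext {n : ℕ}
    (hn : ∀ (X : Type u) [AddCommGroup X] [Module R X] [Module.Finite R X] (j : ℕ), n < j →
      VanishesNear m (Ext (ModuleCat.of R X) N j)) {rs : List R}
    (hm : ∀ r ∈ rs, r ∈ m) (X : Type u) [AddCommGroup X] [Module R X] [Module.Finite R X]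
    (hrs : IsWeaklyRegular X rs) (hj : n < j + rs.length) :
    VanishesNear m (Ext (ModuleCat.of R X) N j) := by
  induction rs generalizing X j with
  | nil => exact hn X j (by simpa using hj)
  | cons x rs ih =>
    obtain ⟨hx, hrs⟩ := (isWeaklyRegular_cons_iff X x rs).1 hrs
    rw [List.length_cons] at hj
    exact .ext_of_quotSMulTop (hm x List.mem_cons_self) hx
      (ih (fun r hr => hm r (List.mem_cons_of_mem _ hr)) (QuotSMulTop x X) hrs (by omega))

end Depth

/-! ### Depth and Krull dimension -/

section DepthOfModules

open RingTheory.Sequence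

variable {R : Type u} [CommRing R] {I : Ideal R} {X : Type u} [AddCommGroup X] [Module R X]

/-- The depth, being finite, is attained by some regular sequence. -/
lemma exists_isRegular_of_isCohenMacaulay {d : ℕ} (h : IsCohenMacaulay I X)
    (hd : Module.supportDim R X = d) :
    ∃ rs : List R, (∀ r ∈ rs, r ∈ I) ∧ IsRegular X rs ∧ d ≤ rs.length := by
  have hdepth : depth I X = d := by
    have := h.trans hd
    exact_mod_cast this
  cases d with
  | zero =>
    have : Nontrivial X := Module.supportDim_ne_bot_iff_nontrivial R X |>.1 (by rw [hd]; simp)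
    exact ⟨[], by simp, .nil R X, Nat.zero_le _⟩
  | succ d =>
    by_contra! H
    have : depth I X ≤ (d : ℕ∞) := iSup₂_le fun rs hrs => by
      exact_mod_cast Nat.lt_succ_iff.1 (H rs hrs.1 hrs.2)
    rw [hdepth] at this
    norm_cast at this
    omega

/-- A regular sequence of length at least the dimension shows that a module is Cohen–Macaulay. -/
lemma isCohenMacaulay_of_isRegular [Module.Finite R X] {rs : List R} (hI : ∀ r ∈ rs, r ∈ I)
    (hrs : IsRegular X rs) (hd : Module.supportDim R X ≤ rs.length) :
    IsCohenMacaulay I X ∧ Module.supportDim R X = rs.length := by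
  have h := le_antisymm hd (length_le_supportDim hrs)
  refine ⟨?_, h⟩
  have h1 : (rs.length : ℕ∞) ≤ depth I X :=
    le_iSup₂_of_le (f := fun (rs : List R) (_ : (∀ r ∈ rs, r ∈ I) ∧ IsRegular X rs) =>
      (rs.length : ℕ∞)) rs ⟨hI, hrs⟩ le_rfl
  have h2 : depth I X ≤ (rs.length : ℕ∞) := iSup₂_le fun qs hqs => by
    have := (length_le_supportDim hqs.2).trans hd
    exact_mod_cast this
  rw [IsCohenMacaulay, h, le_antisymm h2 h1]
  rfl

end DepthOfModules

/-! ### Regular sequences on graded modules over the polynomial ring -/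

section MaxIdeal

open MvPolynomial RingTheory.Sequence Abelian

variable {k : Type u} [Field k] {n : ℕ}

lemma maxIdeal_eq_ker : maxIdeal k n = RingHom.ker (constantCoeff (R := k) (σ := Fin n)) := by
  refine le_antisymm (Ideal.span_le.2 ?_) fun f hf => ?_
  · rintro _ ⟨i, rfl⟩
    exact constantCoeff_X k i
  · rw [maxIdeal, ← Set.image_univ, mem_ideal_span_X_image]
    intro a ha
    by_contra! H
    obtain rfl : a = 0 := by
      ext i
      exact H i trivial
    exact (mem_support_iff.1 ha) hf

instance isMaximal_maxIdeal : (maxIdeal k n).IsMaximal := by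
  rw [maxIdeal_eq_ker]
  exact RingHom.ker_isMaximal_of_surjective _ fun c => ⟨C c, constantCoeff_C _ c⟩

lemma ofList_map_X (l : List (Fin n)) :
    Ideal.ofList (l.map (X (R := k))) = Ideal.span (X '' {i | i ∈ l}) := by
  rw [Ideal.ofList]
  congr 1
  ext f
  simp

/-- Distinct variables form a regular sequence. -/
lemma isWeaklyRegular_map_X {l : List (Fin n)} (hl : l.Nodup) :
    IsWeaklyRegular (MvPolynomial (Fin n) k) (l.map (X (R := k))) := by
  refine ⟨fun i hi => ?_⟩
  rw [List.length_map] at hi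
  rw [← List.map_take, ofList_map_X, isSMulRegular_iff_right_eq_zero_of_smul]
  intro f hf
  obtain ⟨f, rfl⟩ := Submodule.mkQ_surjective _ f
  rw [← map_smul] at hf
  have hf' : X l[i] * f ∈ Ideal.span (X '' {j | j ∈ l.take i}) := by
    have := (Submodule.Quotient.mk_eq_zero _).1 hf
    rwa [smul_eq_mul, Ideal.mul_top, List.getElem_map] at this
  refine (Submodule.Quotient.mk_eq_zero _).2 ?_
  rw [smul_eq_mul, Ideal.mul_top, mem_ideal_span_X_image]
  rw [mem_ideal_span_X_image] at hf'
  intro a ha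
  obtain ⟨j, hj, hja⟩ := hf' (Finsupp.single l[i] 1 + a) (by
    rw [mem_support_iff, coeff_X_mul]
    exact mem_support_iff.1 ha)
  refine ⟨j, hj, ?_⟩
  have hij : l[i] ≠ j := by
    rintro rfl
    obtain ⟨q, hq, hq'⟩ := List.mem_take_iff_getElem.1 hj
    have := (List.Nodup.getElem_inj_iff hl).1 hq'
    omega
  simpa [Finsupp.single_apply, hij] using hja

lemma ofList_map_X_finRange :
    Ideal.ofList ((List.finRange n).map (X (R := k))) = maxIdeal k n := by
  rw [ofList_map_X, maxIdeal, ← Set.image_univ]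
  congr
  ext i
  simp

lemma vanishesNear_ext_polynomial (M : Type u) [AddCommGroup M]
    [Module (MvPolynomial (Fin n) k) M] [Module.Finite (MvPolynomial (Fin n) k) M] (j : ℕ)
    (hj : n < j) : VanishesNear (maxIdeal k n)
      (Ext (ModuleCat.of (MvPolynomial (Fin n) k) M) (ModuleCat.of (MvPolynomial (Fin n) k) (MvPolynomial (Fin n) k)) j) :=
  vanishesNear_ext_of_residue (vanishesNear_ext_residue (by simp)
    (isMaximal_maxIdeal (k := k)).ne_top
    (isWeaklyRegular_map_X (List.nodup_finRange n)) ofList_map_X_finRange).1 M hj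

lemma not_vanishesNear_ext_polynomial : ¬ VanishesNear (maxIdeal k n)
    (Ext (ModuleCat.of (MvPolynomial (Fin n) k) (MvPolynomial (Fin n) k ⧸ maxIdeal k n))
      (ModuleCat.of (MvPolynomial (Fin n) k) (MvPolynomial (Fin n) k)) n) :=
  (vanishesNear_ext_residue (by simp) (isMaximal_maxIdeal (k := k)).ne_top
    (isWeaklyRegular_map_X (List.nodup_finRange n)) ofList_map_X_finRange).2

/-- A graded module which vanishes near the graded maximal ideal is zero. -/
lemma IsGrading.subsingleton_of_vanishesNear {E : Type v} [AddCommGroup E]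
    [Module (MvPolynomial (Fin n) k) E] {ℰ : (Fin n → ℤ) → AddSubgroup E}
    (hE : IsGrading (k := k) ℰ) (h : VanishesNear (maxIdeal k n) E) : Subsingleton E := by
  obtain ⟨s, hs, h⟩ := h
  refine subsingleton_of_forall_eq 0 fun e => ?_
  induction e using homogeneous_induction hE.isInternal with
  | zero => rfl
  | add y z hy hz => rw [hy, hz, add_zero]
  | mem a y hy =>
    -- elements of the maximal ideal have no constant term, so they strictly raise degrees
    have hr : ∀ r ∈ maxIdeal k n, proj hE.isInternal a (r • y) = 0 := by
      intro r hr
      rw [maxIdeal_eq_ker] at hr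
      rw [r.as_sum, Finset.sum_smul, map_sum]
      refine Finset.sum_eq_zero fun b hb => ?_
      refine proj_of_mem_ne hE.isInternal (fun hab => ?_)
        (hE.smul_mem _ _ _ (monomial_mem_polyDeg b _) _ hy)
      obtain rfl : b = 0 := expZ_injective (by
        rw [add_eq_right] at hab
        rw [hab]
        funext i
        simp [expZ])
      exact (mem_support_iff.1 hb) hr
    have h1 := hr _ hs
    rw [sub_smul, h, zero_sub, one_smul, map_neg, proj_of_mem hE.isInternal hy, neg_eq_zero] at h1
    exact h1

variable {M : Type u} [AddCommGroup M] [Module (MvPolynomial (Fin n) k) M]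
  {ℳ : (Fin n → ℤ) → AddSubgroup M}

/-- On a nonzero graded module, weakly regular sequences in the graded maximal ideal are regular. -/
lemma IsGrading.isRegular [Module.Finite (MvPolynomial (Fin n) k) M] [Nontrivial M]
    (hM : IsGrading (k := k) ℳ) {rs : List (MvPolynomial (Fin n) k)}
    (hm : ∀ r ∈ rs, r ∈ maxIdeal k n) (hrs : IsWeaklyRegular M rs) : IsRegular M rs := by
  refine ⟨hrs, fun h => not_subsingleton M ?_⟩
  obtain ⟨s, hs, hs'⟩ := Submodule.exists_sub_one_mem_and_smul_eq_zero_of_fg_of_le_smul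
    (maxIdeal k n) (⊤ : Submodule (MvPolynomial (Fin n) k) M) Module.Finite.fg_top
    (h.le.trans (Submodule.smul_mono_left (Ideal.span_le.2 hm)))
  exact hM.subsingleton_of_vanishesNear ⟨s, hs, fun e => hs' e trivial⟩

lemma IsSq.subsingleton_ext_of_vanishesNear {T : Set (Fin n)} (hM : IsSq (k := k) T ℳ) {j : ℕ}
    (h : VanishesNear (maxIdeal k n) (Ext (ModuleCat.of (MvPolynomial (Fin n) k) M)
      (ModuleCat.of (MvPolynomial (Fin n) k) (MvPolynomial (Fin n) k)) j)) :
    Subsingleton (Ext (ModuleCat.of (MvPolynomial (Fin n) k) M)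
      (ModuleCat.of (MvPolynomial (Fin n) k) (MvPolynomial (Fin n) k)) j) := by
  obtain ⟨P, hP⟩ := hM.exists_gradedResolution
  exact (isSq_extSubgroup hM P hP j).toIsGrading.subsingleton_of_vanishesNear h

/-- A regular sequence of length `t` on a squarefree module `M` forces `Ext^j(M, S) = 0` for
`j > n - t`. -/
lemma IsSq.subsingleton_ext {T : Set (Fin n)} (hM : IsSq (k := k) T ℳ)
    {rs : List (MvPolynomial (Fin n) k)} (hm : ∀ r ∈ rs, r ∈ maxIdeal k n)
    (hrs : IsWeaklyRegular M rs) {j : ℕ} (hj : n < j + rs.length) :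
    Subsingleton (Ext (ModuleCat.of (MvPolynomial (Fin n) k) M)
      (ModuleCat.of (MvPolynomial (Fin n) k) (MvPolynomial (Fin n) k)) j) := by
  have := hM.finite
  exact hM.subsingleton_ext_of_vanishesNear
    (IsWeaklyRegular.vanishesNear_ext (N := ModuleCat.of (MvPolynomial (Fin n) k) (MvPolynomial (Fin n) k))
      (fun M _ _ _ j hj => vanishesNear_ext_polynomial M j hj) hm M hrs hj)

/-- If `Ext^j(M, S) = 0` for `j > n - t`, a nonzero graded module `M` has a regular sequence of
length `t`. -/
lemma IsGrading.exists_isRegular [Module.Finite (MvPolynomial (Fin n) k) M] [Nontrivial M]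
    (hM : IsGrading (k := k) ℳ) (t : ℕ) (h : ∀ j, n < j + t →
      Subsingleton (Ext (ModuleCat.of (MvPolynomial (Fin n) k) M)
        (ModuleCat.of (MvPolynomial (Fin n) k) (MvPolynomial (Fin n) k)) j)) :
    ∃ rs : List (MvPolynomial (Fin n) k), rs.length = t ∧ (∀ r ∈ rs, r ∈ maxIdeal k n) ∧
      IsRegular M rs := by
  obtain ⟨rs, hl, hm, hrs⟩ := exists_isWeaklyRegular_of_vanishesNear_ext
    (N := ModuleCat.of (MvPolynomial (Fin n) k) (MvPolynomial (Fin n) k))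
    (fun M _ _ _ j hj => vanishesNear_ext_polynomial M j hj) not_vanishesNear_ext_polynomial t M
    (fun j hj => by
      have := h j hj
      exact .of_subsingleton _ _)
  exact ⟨rs, hl, hm, hM.isRegular hm hrs⟩

end MaxIdeal

/-! ### The submodule of elements of positive `i`-th degree, and its quotient -/

section Shift

open MvPolynomial

variable {k : Type u} [Field k] {n : ℕ} {M : Type v} [AddCommGroup M]
  [Module (MvPolynomial (Fin n) k) M] {ℳ : (Fin n → ℤ) → AddSubgroup M}

lemma IsGrading.shift (hM : IsGrading (k := k) ℳ) (c : Fin n → ℤ) :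
    IsGrading (k := k) fun a => ℳ (a + c) where
  isInternal := by
    refine isInternal_of_proj (fun y => ?_) (fun a => proj hM.isInternal (a + c))
      (fun a y hy => proj_of_mem _ hy)
      (fun a b hab y hy => proj_of_mem_ne _ (fun h => hab (add_right_cancel h)) hy)
    refine homogeneous_induction hM.isInternal (zero_mem _) (fun _ _ => add_mem)
      (fun a y hy => ?_) y
    refine AddSubgroup.mem_iSup_of_mem (a - c) ?_
    rwa [sub_add_cancel]
  smul_mem a b f hf y hy := by
    rw [add_assoc]
    exact hM.smul_mem a (b + c) f hf y hy

/-- The submodule `⨁_{aᵢ ≥ 1} M_a` of a graded module, defined through the vanishing of the other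
components. -/
noncomputable def posPart (hM : IsGrading (k := k) ℳ) (i : Fin n) :
    Submodule (MvPolynomial (Fin n) k) M where
  carrier := {y | ∀ a : Fin n → ℤ, a i ≤ 0 → proj hM.isInternal a y = 0}
  add_mem' hy hz a ha := by rw [map_add, hy a ha, hz a ha, add_zero]
  zero_mem' a _ := map_zero _
  smul_mem' f y hy a ha := by
    induction f using homogeneous_induction isInternal_polyDeg with
    | zero => rw [zero_smul, map_zero]
    | add f g hf hg => rw [add_smul, map_add, hf, hg, add_zero]
    | mem b f hf =>
      by_cases hb : 0 ≤ b
      · have h := proj_smul hM hf (a - b) y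
        rw [add_sub_cancel] at h
        rw [h, hy _ (by have := hb i; simp only [Pi.zero_apply, Pi.sub_apply] at *; omega),
          smul_zero]
      · rw [eq_zero_of_mem_polyDeg hb hf, zero_smul, map_zero]

lemma mem_posPart_of_mem {hM : IsGrading (k := k) ℳ} {i : Fin n} {a : Fin n → ℤ} (ha : 1 ≤ a i)
    {y : M} (hy : y ∈ ℳ a) : y ∈ posPart hM i := fun b hb => by
  refine proj_of_mem_ne _ ?_ hy
  rintro rfl
  omega

lemma eq_zero_of_mem_posPart {hM : IsGrading (k := k) ℳ} {i : Fin n} {a : Fin n → ℤ} (ha : a i ≤ 0)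
    {y : M} (hy : y ∈ ℳ a) (h : y ∈ posPart hM i) : y = 0 := by
  rw [← proj_of_mem hM.isInternal hy, h a ha]

lemma proj_mem_posPart {hM : IsGrading (k := k) ℳ} {i : Fin n} {y : M} (hy : y ∈ posPart hM i)
    (a : Fin n → ℤ) : proj hM.isInternal a y ∈ posPart hM i := by
  rcases le_or_gt (a i) 0 with ha | ha
  · rw [hy a ha]
    exact zero_mem _
  · exact mem_posPart_of_mem (by omega) (proj_mem _ a y)

/-- The grading of `⨁_{aᵢ ≥ 1} M_a`, shifted by the `i`-th unit vector. -/
noncomputable def posPartDeg (hM : IsGrading (k := k) ℳ) (i : Fin n) (a : Fin n → ℤ) :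
    AddSubgroup (posPart hM i) :=
  subDeg ℳ (posPart hM i) (a + Pi.single i 1)

/-- The shifted module `⨁_{aᵢ ≥ 1} M_a` of a squarefree module `M` is squarefree, and constant in
the direction `i`. -/
lemma IsSq.posPart (hM : IsSq (k := k) ∅ ℳ) (i : Fin n) :
    IsSq (k := k) {i} (posPartDeg hM.toIsGrading i) where
  toIsGrading := (hM.toIsGrading.submodule fun y hy a => proj_mem_posPart hy a).shift _
  finite := by
    have := hM.finite
    infer_instance
  eq_bot a ha := by
    rw [eq_bot_iff]
    intro y hy
    have hy' : (y : M) ∈ ℳ (a + Pi.single i 1) := hy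
    refine Subtype.ext ?_
    by_cases hai : a i < 0
    · exact eq_zero_of_mem_posPart (by simp only [Pi.add_apply, Pi.single_eq_same]; omega) hy' y.2
    · rw [hM.eq_bot, AddSubgroup.mem_bot] at hy'
      · exact hy'
      · refine fun h => ha fun j => ?_
        have := h j
        by_cases hj : j = i
        · subst hj
          simpa using hai
        · simpa [hj] using this
  bijOn a j ha hj := by
    have hpos : 0 ≤ a + Pi.single i 1 := add_nonneg ha (Pi.single_nonneg.2 zero_le_one)
    have h1 : 1 ≤ (a + Pi.single i 1 : Fin n → ℤ) j ∨ j ∈ (∅ : Set (Fin n)) := by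
      left
      have := ha j
      rcases hj with hj | hj
      · have := (Pi.single_nonneg.2 zero_le_one : (0 : Fin n → ℤ) ≤ Pi.single i 1) j
        simp only [Pi.add_apply, Pi.zero_apply] at *
        omega
      · rw [Set.mem_singleton_iff] at hj
        subst hj
        simp only [Pi.add_apply, Pi.single_eq_same, Pi.zero_apply] at *
        omega
    have hb := hM.bijOn _ j hpos h1
    refine ⟨fun y hy => ?_, fun y hy z hz h => ?_, fun y hy => ?_⟩
    · have h2 := hb.mapsTo (show (y : M) ∈ ℳ _ from hy)
      rwa [add_right_comm] at h2
    · exact Subtype.ext (hb.injOn hy hz (congrArg Subtype.val h))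
    · have hy' : (y : M) ∈ ℳ (a + Pi.single j 1 + Pi.single i 1) := hy
      rw [add_right_comm] at hy'
      obtain ⟨z, hz, hzy⟩ := hb.surjOn hy'
      have := ha i
      exact ⟨⟨z, mem_posPart_of_mem (by
        simp only [Pi.add_apply, Pi.single_eq_same, Pi.zero_apply] at *; omega) hz⟩, hz,
        Subtype.ext hzy⟩

/-- The grading of the quotient of `M` by `⨁_{aᵢ ≥ 1} M_a`. -/
noncomputable def quotDeg (hM : IsGrading (k := k) ℳ) (i : Fin n) (a : Fin n → ℤ) :
    AddSubgroup (M ⧸ posPart hM i) :=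
  (ℳ a).map (posPart hM i).mkQ.toAddMonoidHom

lemma mkQ_mem_quotDeg (hM : IsGrading (k := k) ℳ) (i : Fin n) {a : Fin n → ℤ} {y : M}
    (hy : y ∈ ℳ a) : (posPart hM i).mkQ y ∈ quotDeg hM i a :=
  ⟨y, hy, rfl⟩

lemma mem_quotDeg_iff {hM : IsGrading (k := k) ℳ} {i : Fin n} {a : Fin n → ℤ}
    {y : M ⧸ posPart hM i} : y ∈ quotDeg hM i a ↔ ∃ z ∈ ℳ a, (posPart hM i).mkQ z = y := Iff.rfl

lemma isGrading_quotDeg (hM : IsGrading (k := k) ℳ) (i : Fin n) :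
    IsGrading (k := k) (quotDeg hM i) where
  isInternal := by
    refine isInternal_of_sum_eq_zero (fun y => ?_) (fun s f hf hs a ha => ?_)
    · obtain ⟨y, rfl⟩ := Submodule.mkQ_surjective _ y
      obtain ⟨s, hs⟩ := exists_sum_proj hM.isInternal y
      rw [← hs, map_sum]
      exact sum_mem fun a _ => AddSubgroup.mem_iSup_of_mem a (mkQ_mem_quotDeg hM i (proj_mem _ a y))
    · choose g hg hgf using fun a => mem_quotDeg_iff.1 (hf a)
      simp only [← hgf, ← map_sum] at hs ⊢
      have h1 : ∑ b ∈ s, g b ∈ posPart hM i := (Submodule.Quotient.mk_eq_zero _).1 hs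
      have h2 := proj_mem_posPart h1 a
      rw [proj_sum_of_mem hM.isInternal s g (fun b _ => hg b) ha] at h2
      exact (Submodule.Quotient.mk_eq_zero _).2 h2
  smul_mem a b f hf y hy := by
    obtain ⟨z, hz, rfl⟩ := mem_quotDeg_iff.1 hy
    rw [← map_smul]
    exact mkQ_mem_quotDeg hM i (hM.smul_mem a b f hf z hz)

lemma quotDeg_eq_bot (hM : IsGrading (k := k) ℳ) {i : Fin n} {a : Fin n → ℤ} (ha : 1 ≤ a i) :
    quotDeg hM i a = ⊥ := by
  rw [eq_bot_iff]
  intro y hy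
  obtain ⟨z, hz, rfl⟩ := mem_quotDeg_iff.1 hy
  exact (Submodule.Quotient.mk_eq_zero _).2 (mem_posPart_of_mem ha hz)

/-- The quotient of a squarefree module by `⨁_{aᵢ ≥ 1} M_a` is squarefree. -/
lemma IsSq.quot (hM : IsSq (k := k) ∅ ℳ) (i : Fin n) :
    IsSq (k := k) ∅ (quotDeg hM.toIsGrading i) where
  toIsGrading := isGrading_quotDeg hM.toIsGrading i
  finite := by
    have := hM.finite
    infer_instance
  eq_bot a ha := by
    rw [eq_bot_iff]
    intro y hy
    obtain ⟨z, hz, rfl⟩ := mem_quotDeg_iff.1 hy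
    rw [hM.eq_bot a ha, AddSubgroup.mem_bot] at hz
    rw [hz, map_zero]
    exact zero_mem _
  bijOn a j ha hj := by
    by_cases hai : 1 ≤ a i
    · have h0 : 1 ≤ (a + Pi.single j 1 : Fin n → ℤ) i := by
        have := (Pi.single_nonneg.2 zero_le_one : (0 : Fin n → ℤ) ≤ Pi.single j 1) i
        simp only [Pi.add_apply, Pi.zero_apply] at *
        omega
      rw [quotDeg_eq_bot _ hai, quotDeg_eq_bot _ h0]
      refine ⟨fun y hy => ?_, fun y hy z hz _ => ?_, fun y hy => ⟨0, rfl, ?_⟩⟩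
      · rw [show y = 0 from hy]
        exact smul_zero _
      · rw [show y = 0 from hy, show z = 0 from hz]
      · rw [show y = 0 from hy]
        exact smul_zero _
    · have hji : i ≠ j := by
        rintro rfl
        simp only [Set.mem_empty_iff_false, or_false] at hj
        exact hai hj
      have hb := hM.bijOn a j ha hj
      refine ⟨fun y hy => (isGrading_quotDeg _ i).X_smul_mem j hy, fun y hy y' hy' h => ?_,
        fun y hy => ?_⟩
      · obtain ⟨z, hz, rfl⟩ := mem_quotDeg_iff.1 hy
        obtain ⟨z', hz', rfl⟩ := mem_quotDeg_iff.1 hy'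
        congr 1
        refine hb.injOn hz hz' (sub_eq_zero.1 ?_)
        refine eq_zero_of_mem_posPart (hM := hM.toIsGrading) (i := i) ?_
          (sub_mem (hb.mapsTo hz) (hb.mapsTo hz')) ?_
        · rw [Pi.add_apply, Pi.single_eq_of_ne hji]
          omega
        · refine (Submodule.Quotient.eq _).1 ?_
          exact h
      · obtain ⟨z, hz, rfl⟩ := mem_quotDeg_iff.1 hy
        obtain ⟨w, hw, rfl⟩ := hb.surjOn hz
        exact ⟨(SquarefreeModule.posPart hM.toIsGrading i).mkQ w, mkQ_mem_quotDeg _ i hw,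
          (map_smul _ _ _).symm⟩

/-- Multiplication by `xᵢ`, as a map to `⨁_{aᵢ ≥ 1} M_a`. -/
noncomputable def IsSq.mulX {T : Set (Fin n)} (hM : IsSq (k := k) T ℳ) (i : Fin n) :
    M →ₗ[MvPolynomial (Fin n) k] SquarefreeModule.posPart hM.toIsGrading i :=
  (LinearMap.lsmul (MvPolynomial (Fin n) k) M (X i)).codRestrict _ fun y => by
    refine homogeneous_induction hM.isInternal ?_ (fun y z hy hz => ?_) (fun a y hy => ?_) y
    · rw [map_zero]
      exact zero_mem _
    · rw [map_add]
      exact add_mem hy hz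
    · change (X i : MvPolynomial (Fin n) k) • y ∈ _
      by_cases ha : 0 ≤ a
      · refine mem_posPart_of_mem ?_ (hM.toIsGrading.X_smul_mem i hy)
        have := ha i
        simp only [Pi.add_apply, Pi.single_eq_same, Pi.zero_apply] at *
        omega
      · rw [hM.eq_bot a ha, AddSubgroup.mem_bot] at hy
        rw [hy, smul_zero]
        exact zero_mem _

lemma IsSq.isHomogeneousMap_mulX (hM : IsSq (k := k) ∅ ℳ) (i : Fin n) :
    IsHomogeneousMap ℳ (posPartDeg hM.toIsGrading i) 0 (hM.mulX i) := fun b y hy => by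
  rw [zero_add]
  exact hM.toIsGrading.X_smul_mem i hy

lemma IsSq.isHomogeneousMap_subtype (hM : IsSq (k := k) ∅ ℳ) (i : Fin n) :
    IsHomogeneousMap (posPartDeg hM.toIsGrading i) ℳ (Pi.single i 1)
      (SquarefreeModule.posPart hM.toIsGrading i).subtype := fun b y hy => by
  rw [add_comm]
  exact hy

end Shift

/-! ### Generation in degree `0` -/

section Generation

open MvPolynomial

variable {k : Type u} [Field k] {n : ℕ} {E F : Type v} [AddCommGroup E]
  [Module (MvPolynomial (Fin n) k) E] [AddCommGroup F] [Module (MvPolynomial (Fin n) k) F]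
  {ℰ : (Fin n → ℤ) → AddSubgroup E} {ℱ : (Fin n → ℤ) → AddSubgroup F}

/-- If multiplication by `xᵢ` on two squarefree modules factors through maps `α : E → F` and
`β : F → E` of degree `eᵢ` and `0`, and if `F` vanishes in degrees `a` with `aᵢ ≤ 0`, then
`α` is surjective if and only if every element of `E` of a degree with `aᵢ = 1` is
divisible by `xᵢ`. -/
lemma surjective_iff_of_comp_eq_X_smul {i : Fin n} (hE : IsSq (k := k) ∅ ℰ)
    (hF : IsSq (k := k) ∅ ℱ) (hFi : ∀ a, a i ≤ 0 → ℱ a = ⊥)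
    {α : E →ₗ[MvPolynomial (Fin n) k] F} {β : F →ₗ[MvPolynomial (Fin n) k] E}
    (hα : IsHomogeneousMap ℰ ℱ (Pi.single i 1) α) (hβ : IsHomogeneousMap ℱ ℰ 0 β)
    (hαβ : ∀ v, α (β v) = (X i : MvPolynomial (Fin n) k) • v)
    (hβα : ∀ e, β (α e) = (X i : MvPolynomial (Fin n) k) • e) :
    Function.Surjective α ↔ ∀ a : Fin n → ℤ, 0 ≤ a → a i = 0 → ∀ y ∈ ℰ (a + Pi.single i 1),
      ∃ z ∈ ℰ a, (X i : MvPolynomial (Fin n) k) • z = y := by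
  have hs : (0 : Fin n → ℤ) ≤ Pi.single i 1 := Pi.single_nonneg.2 zero_le_one
  constructor
  -- write `α y = xᵢ v` and `v = α z`; then `xᵢ y = β (α y) = xᵢ (β v)`, so `y = β (α z) = xᵢ z`
  · intro h a ha hai y hy
    have ha' : 0 ≤ a + Pi.single i 1 := add_nonneg ha hs
    have h1 : 1 ≤ (a + Pi.single i 1 : Fin n → ℤ) i := by rw [Pi.add_apply, hai, Pi.single_eq_same, zero_add]
    have hw := hα _ y hy
    rw [add_comm] at hw
    obtain ⟨v, hv, hvy⟩ := (hF.bijOn _ i ha' (Or.inl h1)).surjOn hw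
    have hβv : β v ∈ ℰ (a + Pi.single i 1) := by
      have := hβ _ v hv
      rwa [zero_add] at this
    obtain ⟨z, hz⟩ := h v
    refine ⟨proj hE.isInternal a z, proj_mem _ _ _, ?_⟩
    have hz' : α (proj hE.isInternal a z) = v := by
      rw [← hα.proj_map (h𝒩 := hF.isInternal), hz, add_comm, proj_of_mem _ hv]
    rw [← hβα, hz']
    refine (hE.bijOn _ i ha' (Or.inl h1)).injOn hβv hy ?_
    rw [← hβα y, ← map_smul]
    exact congrArg β hvy
  -- write `β v = xᵢ z`; then `xᵢ v = α (β v) = xᵢ (α z)`, so `v = α z`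
  · intro h v
    rw [← LinearMap.mem_range]
    refine homogeneous_induction hF.isInternal (zero_mem _) (fun _ _ => add_mem)
      (fun b v hv => ?_) v
    by_cases hb : 0 ≤ b
    · by_cases hbi : b i ≤ 0
      · rw [hFi b hbi, AddSubgroup.mem_bot] at hv
        rw [hv]
        exact zero_mem _
      · obtain ⟨a, rfl⟩ : ∃ a, a + Pi.single i 1 = b := ⟨b - Pi.single i 1, sub_add_cancel _ _⟩
        simp only [Pi.add_apply, Pi.single_eq_same] at hbi
        have ha : 0 ≤ a := fun j => by
          have := hb j
          by_cases hj : j = i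
          · subst hj
            simp only [Pi.zero_apply]
            omega
          · simpa [hj] using this
        have hβv : β v ∈ ℰ (a + Pi.single i 1) := by
          have := hβ _ v hv
          rwa [zero_add] at this
        obtain ⟨z, hz, hzv⟩ : ∃ z ∈ ℰ a, (X i : MvPolynomial (Fin n) k) • z = β v := by
          by_cases hai : a i = 0
          · exact h a ha hai _ hβv
          · have h1 : 1 ≤ a i := by
              have := ha i
              simp only [Pi.zero_apply] at this
              omega
            exact (hE.bijOn a i ha (Or.inl h1)).surjOn hβv
        refine ⟨z, ?_⟩
        have hαz := hα _ z hz
        rw [add_comm] at hαz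
        refine (hF.bijOn _ i hb (Or.inl ?_)).injOn hαz hv ?_
        · simp only [Pi.add_apply, Pi.single_eq_same]
          omega
        · rw [← map_smul, hzv, hαβ]
    · rw [hF.eq_bot b hb, AddSubgroup.mem_bot] at hv
      rw [hv]
      exact zero_mem _

/-- A squarefree module is generated in degree `0` if and only if every element of a degree with
`aᵢ = 1` is divisible by `xᵢ`, for all `i`. -/
lemma span_degree_zero_eq_top_iff (hE : IsSq (k := k) ∅ ℰ) :
    Submodule.span (MvPolynomial (Fin n) k) (ℰ 0 : Set E) = ⊤ ↔
      ∀ i, ∀ a : Fin n → ℤ, 0 ≤ a → a i = 0 → ∀ y ∈ ℰ (a + Pi.single i 1),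
        ∃ z ∈ ℰ a, (X i : MvPolynomial (Fin n) k) • z = y := by
  constructor
  · intro h i a ha hai y hy
    have H : ∀ y ∈ Submodule.span (MvPolynomial (Fin n) k) (ℰ 0 : Set E),
        ∃ z ∈ ℰ a, (X i : MvPolynomial (Fin n) k) • z =
          proj hE.isInternal (a + Pi.single i 1) y := by
      intro y hy
      induction hy using Submodule.closure_induction with
      | zero => exact ⟨0, zero_mem _, by rw [smul_zero, map_zero]⟩
      | add y y' _ _ hy hy' =>
        obtain ⟨z, hz, hzy⟩ := hy
        obtain ⟨z', hz', hzy'⟩ := hy'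
        exact ⟨z + z', add_mem hz hz', by rw [smul_add, hzy, hzy', map_add]⟩
      | smul_mem f e he =>
        induction f using homogeneous_induction isInternal_polyDeg with
        | zero => exact ⟨0, zero_mem _, by rw [smul_zero, zero_smul, map_zero]⟩
        | add f f' hf hf' =>
          obtain ⟨z, hz, hzy⟩ := hf
          obtain ⟨z', hz', hzy'⟩ := hf'
          exact ⟨z + z', add_mem hz hz', by rw [smul_add, hzy, hzy', add_smul, map_add]⟩
        | mem c f hf =>
          have hfe := hE.smul_mem _ _ _ hf _ he
          rw [add_zero] at hfe
          by_cases hc : c = a + Pi.single i 1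
          · subst hc
            obtain ⟨g, rfl⟩ := X_dvd_of_mem_polyDeg (i := i) (by
              rw [Pi.add_apply, hai, Pi.single_eq_same, zero_add]) hf
            refine ⟨g • e, ?_, ?_⟩
            · have := hE.smul_mem _ _ _ (mem_polyDeg_of_X_mul_mem hf) _ he
              rwa [add_zero] at this
            · rw [proj_of_mem _ hfe, mul_smul]
          · exact ⟨0, zero_mem _, by rw [smul_zero, proj_of_mem_ne _ hc hfe]⟩
    obtain ⟨z, hz, hzy⟩ := H y (h ▸ Submodule.mem_top)
    rw [proj_of_mem _ hy] at hzy
    exact ⟨z, hz, hzy⟩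
  · intro h
    have H : ∀ (N : ℕ) (a : Fin n → ℤ), 0 ≤ a → ∑ i, a i = N → ∀ y ∈ ℰ a,
        y ∈ Submodule.span (MvPolynomial (Fin n) k) (ℰ 0 : Set E) := by
      intro N
      induction N with
      | zero =>
        intro a ha hsum y hy
        obtain rfl : a = 0 := by
          funext i
          exact (Finset.sum_eq_zero_iff_of_nonneg fun i _ => ha i).1 hsum i (Finset.mem_univ i)
        exact Submodule.subset_span hy
      | succ N ih =>
        intro b hb hsum y hy
        obtain ⟨i, hi⟩ : ∃ i, 1 ≤ b i := by
          by_contra! H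
          have : ∑ i, b i ≤ 0 := Finset.sum_nonpos fun i _ => by have := H i; omega
          omega
        obtain ⟨a, rfl⟩ : ∃ a, a + Pi.single i 1 = b := ⟨b - Pi.single i 1, sub_add_cancel _ _⟩
        simp only [Pi.add_apply, Pi.single_eq_same] at hi
        have ha : 0 ≤ a := fun j => by
          have := hb j
          by_cases hj : j = i
          · subst hj
            simp only [Pi.zero_apply]
            omega
          · simpa [hj] using this
        obtain ⟨z, hz, rfl⟩ : ∃ z ∈ ℰ a, (X i : MvPolynomial (Fin n) k) • z = y := by
          by_cases hai : a i = 0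
          · exact h i a ha hai _ hy
          · have h1 : 1 ≤ a i := by
              have := ha i
              simp only [Pi.zero_apply] at this
              omega
            exact (hE.bijOn a i ha (Or.inl h1)).surjOn hy
        refine Submodule.smul_mem _ _ (ih a ha ?_ z hz)
        have : ∑ j, (a + Pi.single i 1 : Fin n → ℤ) j = ∑ j, a j + 1 := by
          simp [Finset.sum_add_distrib]
        rw [this] at hsum
        push_cast at hsum
        omega
    refine Submodule.eq_top_iff'.2 fun y => ?_
    refine homogeneous_induction hE.isInternal (zero_mem _) (fun _ _ => add_mem)
      (fun a y hy => ?_) y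
    by_cases ha : 0 ≤ a
    · refine H (∑ i, a i).toNat a ha ?_ y hy
      rw [Int.toNat_of_nonneg (Finset.sum_nonneg fun i _ => ha i)]
    · rw [hE.eq_bot a ha, AddSubgroup.mem_bot] at hy
      rw [hy]
      exact zero_mem _

end Generation

/-! ### Depth and dimension along a surjection of rings -/

section ChangeOfRings

open RingTheory.Sequence

variable {A B : Type u} [CommRing A] [CommRing B] {L N : Type u} [AddCommGroup L] [AddCommGroup N]
  [Module A L] [Module B N] {ρ : B →+* A} {e : L ≃+ N}

lemma finite_of_addEquiv (he : ∀ b l, e (ρ b • l) = b • e l) [Module.Finite B N] :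
    Module.Finite A L := by
  obtain ⟨s, hs⟩ := Module.Finite.fg_top (R := B) (M := N)
  classical
  refine ⟨⟨s.image e.symm, Submodule.eq_top_iff'.2 fun l => ?_⟩⟩
  have H : ∀ y ∈ Submodule.span B (s : Set N),
      e.symm y ∈ Submodule.span A ((s.image e.symm : Finset L) : Set L) := by
    intro y hy
    induction hy using Submodule.span_induction with
    | mem y hy => exact Submodule.subset_span (Finset.mem_image_of_mem _ hy)
    | zero => rw [map_zero]; exact zero_mem _
    | add y z _ _ hy hz => rw [map_add]; exact add_mem hy hz
    | smul b y _ hy =>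
      have : e.symm (b • y) = ρ b • e.symm y := by
        rw [AddEquiv.symm_apply_eq, he, e.apply_symm_apply]
      rw [this]
      exact Submodule.smul_mem _ _ hy
  have := H (e l) (hs ▸ Submodule.mem_top)
  rwa [e.symm_apply_apply] at this

lemma supportDim_congr (hρ : Function.Surjective ρ) (he : ∀ b l, e (ρ b • l) = b • e l)
    [Module.Finite B N] : Module.supportDim A L = Module.supportDim B N := by
  have := finite_of_addEquiv he
  rw [Module.supportDim_eq_ringKrullDim_quotient_annihilator,
    Module.supportDim_eq_ringKrullDim_quotient_annihilator]
  have hker : RingHom.ker ((Ideal.Quotient.mk (Module.annihilator A L)).comp ρ) =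
      Module.annihilator B N := by
    ext b
    rw [RingHom.mem_ker, RingHom.comp_apply, Ideal.Quotient.eq_zero_iff_mem,
      Module.mem_annihilator, Module.mem_annihilator]
    refine ⟨fun h y => ?_, fun h l => e.injective ?_⟩
    · rw [← e.apply_symm_apply y, ← he, h, map_zero]
    · rw [he, h, map_zero]
  refine (ringKrullDim_eq_of_ringEquiv ((Ideal.quotEquivOfEq hker).symm.trans
    (RingHom.quotientKerEquivOfSurjective
      (Ideal.Quotient.mk_surjective.comp hρ)))).symm

lemma depth_congr {I : Ideal A} {J : Ideal B} (hJ : ∀ b ∈ J, ρ b ∈ I)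
    (hI : ∀ a ∈ I, ∃ b ∈ J, ρ b = a) (he : ∀ b l, e (ρ b • l) = b • e l) :
    depth I L = depth J N := by
  have key (rs : List B) : IsRegular L (rs.map ρ) ↔ IsRegular N rs :=
    e.isRegular_congr (List.forall₂_map_left_iff.2 (List.forall₂_same.2 fun b _ => he b))
  refine le_antisymm (iSup₂_le fun rs hrs => ?_) (iSup₂_le fun rs hrs => ?_)
  · choose f hf hf' using hI
    have hmap : (rs.attach.map fun r => f r.1 (hrs.1 r.1 r.2)).map ρ = rs := by
      rw [List.map_map]
      conv_rhs => rw [← List.attach_map_subtype_val rs]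
      exact List.map_congr_left fun r _ => hf' _ _
    refine le_iSup₂_of_le (f := fun (rs : List B) (_ : (∀ r ∈ rs, r ∈ J) ∧ IsRegular N rs) =>
      (rs.length : ℕ∞)) (rs.attach.map fun r => f r.1 (hrs.1 r.1 r.2)) ⟨?_, ?_⟩ (by simp)
    · intro b hb
      obtain ⟨r, -, rfl⟩ := List.mem_map.1 hb
      exact hf _ _
    · rw [← key, hmap]
      exact hrs.2
  · refine le_iSup₂_of_le (f := fun (rs : List A) (_ : (∀ r ∈ rs, r ∈ I) ∧ IsRegular L rs) =>
      (rs.length : ℕ∞)) (rs.map ρ) ⟨?_, (key rs).2 hrs.2⟩ (by simp)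
    intro a ha
    obtain ⟨b, hb, rfl⟩ := List.mem_map.1 ha
    exact hJ b (hrs.1 b hb)

lemma isZeroOrCohenMacaulayOfDim_iff {M : Type u} [AddCommGroup M] [Module A M] {L : Submodule A M}
    {I : Ideal A} {J : Ideal B} (hρ : Function.Surjective ρ) (hJ : ∀ b ∈ J, ρ b ∈ I)
    (hI : ∀ a ∈ I, ∃ b ∈ J, ρ b = a) [Module.Finite B N] (π : M →+ N)
    (hπ : Set.BijOn π (L : Set M) Set.univ) (hsmul : ∀ b, ∀ y ∈ L, π (ρ b • y) = b • π y)
    (d : WithBot ℕ∞) :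
    IsZeroOrCohenMacaulayOfDim I L d ↔
      (Subsingleton N ∨ IsCohenMacaulay J N ∧ Module.supportDim B N = d) := by
  let e : L ≃+ N := AddEquiv.ofBijective (π.comp L.subtype.toAddMonoidHom)
    ⟨fun y z h => Subtype.ext (hπ.injOn y.2 z.2 h), fun y => by
      obtain ⟨z, hz, hzy⟩ := hπ.surjOn (Set.mem_univ y)
      exact ⟨⟨z, hz⟩, hzy⟩⟩
  have he : ∀ b (l : L), e (ρ b • l) = b • e l := fun b l => hsmul b l l.2
  rw [IsZeroOrCohenMacaulayOfDim, IsCohenMacaulay, IsCohenMacaulay, supportDim_congr hρ he,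
    depth_congr hJ hI he, ← Submodule.subsingleton_iff_eq_bot, e.toEquiv.subsingleton_congr]

end ChangeOfRings

/-! ### Restrictions of squarefree modules -/

section Restrict

open MvPolynomial

variable {k : Type u} [Field k] {n : ℕ}

open Classical in
/-- The retraction `k[x₁, …, xₙ] → k[xᵢ ∣ i ∈ V]` which maps the other variables to zero. -/
noncomputable def retract (V : Set (Fin n)) : MvPolynomial (Fin n) k →ₐ[k] supported k V :=
  aeval fun i => if h : i ∈ V then ⟨X i, (X_mem_supported (R := k)).2 h⟩ else 0

lemma coe_retract_X_of_mem {V : Set (Fin n)} {i : Fin n} (hi : i ∈ V) :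
    (retract V (X i : MvPolynomial (Fin n) k) : MvPolynomial (Fin n) k) = X i := by
  rw [retract, aeval_X, dif_pos hi]

lemma retract_X_of_notMem {V : Set (Fin n)} {i : Fin n} (hi : i ∉ V) :
    retract V (X i : MvPolynomial (Fin n) k) = 0 := by
  rw [retract, aeval_X, dif_neg hi]

lemma retract_coe {V : Set (Fin n)} (f : supported k V) :
    retract V (f : MvPolynomial (Fin n) k) = f := by
  obtain ⟨f, hf⟩ := f
  refine Subtype.ext ?_
  change ((retract V f : supported k V) : MvPolynomial (Fin n) k) = f
  induction hf using Algebra.adjoin_induction with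
  | mem f hf =>
    obtain ⟨i, hi, rfl⟩ := hf
    exact coe_retract_X_of_mem hi
  | algebraMap c => rw [AlgHom.commutes]; rfl
  | add f g _ _ hf hg => rw [map_add, Subalgebra.coe_add, hf, hg]
  | mul f g _ _ hf hg => rw [map_mul, Subalgebra.coe_mul, hf, hg]

lemma retract_mem_maxIdealOn {V : Set (Fin n)} {f : MvPolynomial (Fin n) k}
    (hf : f ∈ maxIdeal k n) : retract V f ∈ maxIdealOn k V := by
  have : maxIdeal k n ≤ (maxIdealOn k V).comap (retract V) := by
    refine Ideal.span_le.2 ?_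
    rintro _ ⟨i, rfl⟩
    change retract V (X i : MvPolynomial (Fin n) k) ∈ maxIdealOn k V
    by_cases hi : i ∈ V
    · exact Ideal.subset_span ⟨i, hi, coe_retract_X_of_mem hi⟩
    · rw [retract_X_of_notMem hi]
      exact zero_mem _
  exact this hf

lemma coe_mem_maxIdeal {V : Set (Fin n)} {f : supported k V} (hf : f ∈ maxIdealOn k V) :
    (f : MvPolynomial (Fin n) k) ∈ maxIdeal k n := by
  have : maxIdealOn k V ≤ (maxIdeal k n).comap (supported k V).val.toRingHom := by
    refine Ideal.span_le.2 ?_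
    rintro f ⟨i, -, hf⟩
    have : (X i : MvPolynomial (Fin n) k) ∈ maxIdeal k n := Ideal.subset_span ⟨i, rfl⟩
    rwa [← hf] at this
  exact this hf

variable {M N : Type u} [AddCommGroup M] [Module (MvPolynomial (Fin n) k) M] [AddCommGroup N]
  [Module (MvPolynomial (Fin n) k) N] {ℳ : (Fin n → ℤ) → AddSubgroup M}

lemma coe_retract_smul {V : Set (Fin n)}
    (hN : ∀ i ∉ V, ∀ y : N, (X i : MvPolynomial (Fin n) k) • y = 0)
    (f : MvPolynomial (Fin n) k) (y : N) :
    ((retract V f : supported k V) : MvPolynomial (Fin n) k) • y = f • y := by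
  induction f using MvPolynomial.induction_on generalizing y with
  | C c =>
    have : retract V (C c : MvPolynomial (Fin n) k) = algebraMap k _ c := (retract V).commutes c
    rw [this]
    rfl
  | add f g hf hg => rw [map_add, Subalgebra.coe_add, add_smul, hf, hg, add_smul]
  | mul_X f i hf =>
    rw [map_mul, Subalgebra.coe_mul, mul_smul, mul_smul]
    by_cases hi : i ∈ V
    · rw [coe_retract_X_of_mem hi, hf]
    · rw [retract_X_of_notMem hi, hN i hi, ZeroMemClass.coe_zero, zero_smul, smul_zero, smul_zero]

/-- Let `N` be a finitely generated module on which the variables outside `V` act as zero, and which is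
identified with the restriction `M|_V`. Then `M|_V` over `k[xᵢ ∣ i ∈ V]` is zero or Cohen–Macaulay of dimension `d`
if and only if `N` over `k[x₁, …, xₙ]` is. -/
lemma isZeroOrCohenMacaulayOfDim_restrict_iff (hM : IsGrading (k := k) ℳ) {V : Set (Fin n)}
    [Module.Finite (MvPolynomial (Fin n) k) N]
    (hN : ∀ i ∉ V, ∀ y : N, (X i : MvPolynomial (Fin n) k) • y = 0)
    (π : M →ₗ[MvPolynomial (Fin n) k] N)
    (hπ : Set.BijOn π (restrict hM V : Set M) Set.univ) (d : WithBot ℕ∞) :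
    IsZeroOrCohenMacaulayOfDim (maxIdealOn k V) (restrict hM V) d ↔
      (Subsingleton N ∨ IsCohenMacaulay (maxIdeal k n) N ∧
        Module.supportDim (MvPolynomial (Fin n) k) N = d) := by
  exact isZeroOrCohenMacaulayOfDim_iff (ρ := (retract (k := k) V).toRingHom)
    (fun f => ⟨f, retract_coe f⟩) (fun b hb => retract_mem_maxIdealOn hb)
    (fun a ha => ⟨a, coe_mem_maxIdeal ha, retract_coe a⟩) π.toAddMonoidHom hπ
    (fun b y _ => (map_smul π _ y).trans (coe_retract_smul hN b (π y))) d

lemma restrictAux_univ (hM : IsSq (k := k) ∅ ℳ) (y : M) : y ∈ restrictAux ℳ Set.univ := by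
  refine homogeneous_induction hM.isInternal (zero_mem _) (fun _ _ => add_mem) (fun a y hy => ?_) y
  by_cases ha : 0 ≤ a
  · obtain ⟨a, rfl⟩ := exists_expZ_eq ha
    exact mem_restrictAux (Set.subset_univ _) hy
  · rw [hM.eq_bot a ha, AddSubgroup.mem_bot] at hy
    rw [hy]
    exact zero_mem _

/-- The quotient of `M` by `⨁_{aᵢ ≥ 1} M_a` is the restriction of `M` to the complement of `i`. -/
lemma bijOn_mkQ_restrict (hM : IsSq (k := k) ∅ ℳ) (i : Fin n) :
    Set.BijOn (posPart hM.toIsGrading i).mkQ (restrict hM.toIsGrading ({i} : Set (Fin n))ᶜ : Set M)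
      Set.univ := by
  have hcomp : ∀ y ∈ restrictAux ℳ ({i} : Set (Fin n))ᶜ, ∀ a : Fin n → ℤ, a i ≠ 0 →
      proj hM.isInternal a y = 0 := by
    have : restrictAux ℳ ({i} : Set (Fin n))ᶜ ≤
        ⨅ (a : Fin n → ℤ) (_ : a i ≠ 0), (proj hM.isInternal a).ker := by
      refine iSup₂_le fun b hb y hy => ?_
      simp only [AddSubgroup.mem_iInf]
      intro a ha
      refine proj_of_mem_ne _ ?_ hy
      rintro rfl
      refine ha ?_
      by_contra h
      exact hb (Finsupp.mem_support_iff.2 fun h' => h (by simp [expZ, h'])) rfl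
    intro y hy a ha
    have := this hy
    simp only [AddSubgroup.mem_iInf] at this
    exact this a ha
  refine ⟨fun _ _ => trivial, fun y hy z hz h => ?_, fun y _ => ?_⟩
  · have h1 := (Submodule.Quotient.eq _).1 h
    rw [← sub_eq_zero]
    refine eq_zero_of_proj_eq_zero hM.isInternal fun a => ?_
    by_cases ha : a i = 0
    · exact h1 a ha.le
    · exact hcomp _ (sub_mem hy hz) a ha
  · obtain ⟨y, rfl⟩ := Submodule.mkQ_surjective _ y
    refine homogeneous_induction hM.isInternal ?_ (fun y z hy hz => ?_) (fun a y hy => ?_) y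
    · exact ⟨0, zero_mem _, rfl⟩
    · obtain ⟨y', hy', h⟩ := hy
      obtain ⟨z', hz', h'⟩ := hz
      exact ⟨y' + z', add_mem hy' hz', by rw [map_add, map_add, h, h']⟩
    · by_cases ha : 0 ≤ a
      · by_cases hai : a i = 0
        · obtain ⟨a, rfl⟩ := exists_expZ_eq ha
          refine ⟨y, mem_restrictAux ?_ hy, rfl⟩
          rintro j hj rfl
          refine Finsupp.mem_support_iff.1 hj ?_
          simpa [expZ] using hai
        · refine ⟨0, zero_mem _, ?_⟩
          rw [map_zero]
          refine ((Submodule.Quotient.mk_eq_zero _).2 (mem_posPart_of_mem ?_ hy)).symm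
          have := ha i
          simp only [Pi.zero_apply] at this
          omega
      · rw [hM.eq_bot a ha, AddSubgroup.mem_bot] at hy
        exact ⟨0, zero_mem _, by rw [hy]⟩

lemma X_smul_quot_posPart (hM : IsSq (k := k) ∅ ℳ) (i : Fin n)
    (y : M ⧸ posPart hM.toIsGrading i) :
    (X i : MvPolynomial (Fin n) k) • y = 0 := by
  obtain ⟨y, rfl⟩ := Submodule.mkQ_surjective _ y
  rw [← map_smul]
  exact (Submodule.Quotient.mk_eq_zero _).2 (hM.mulX i y).2

end Restrict

/-! ### `Ext` of the restrictions, and the main result -/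

section Main

open MvPolynomial Abelian RingTheory.Sequence

variable {k : Type u} [Field k] {n : ℕ} {M : Type u} [AddCommGroup M]
  [Module (MvPolynomial (Fin n) k) M] {ℳ : (Fin n → ℤ) → AddSubgroup M}

variable (k n) in
/-- The polynomial ring as an object of the category of modules over itself. -/
noncomputable abbrev selfModule : ModuleCat.{u} (MvPolynomial (Fin n) k) :=
  ModuleCat.of (MvPolynomial (Fin n) k) (MvPolynomial (Fin n) k)

/-- The map on `Ext^j(-, S)` induced by a linear map. -/
noncomputable def extMap {L M : Type u} [AddCommGroup L] [Module (MvPolynomial (Fin n) k) L]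
    [AddCommGroup M] [Module (MvPolynomial (Fin n) k) M] (ψ : L →ₗ[MvPolynomial (Fin n) k] M)
    (j : ℕ) :
    Ext (ModuleCat.of (MvPolynomial (Fin n) k) M) (selfModule k n) j
      →ₗ[MvPolynomial (Fin n) k] Ext (ModuleCat.of (MvPolynomial (Fin n) k) L) (selfModule k n) j where
  toFun e := (Ext.mk₀ (ModuleCat.ofHom ψ)).comp e (zero_add j)
  map_add' _ _ := Ext.comp_add _ _ _ _
  map_smul' _ _ := Ext.comp_smul _ _ _ _

lemma extMap_extMap {L M : Type u} [AddCommGroup L] [Module (MvPolynomial (Fin n) k) L]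
    [AddCommGroup M] [Module (MvPolynomial (Fin n) k) M] {φ : L →ₗ[MvPolynomial (Fin n) k] M}
    {ψ : M →ₗ[MvPolynomial (Fin n) k] L} {f : MvPolynomial (Fin n) k}
    (h : ψ ∘ₗ φ = f • LinearMap.id) {j : ℕ}
    (e : Ext (ModuleCat.of (MvPolynomial (Fin n) k) L) (selfModule k n) j) :
    extMap φ j (extMap ψ j e) = f • e := by
  have h' : ModuleCat.ofHom φ ≫ ModuleCat.ofHom ψ = f • 𝟙 _ := by
    rw [← ModuleCat.ofHom_comp, h]
    rfl
  change (Ext.mk₀ (ModuleCat.ofHom φ)).comp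
    ((Ext.mk₀ (ModuleCat.ofHom ψ)).comp e (zero_add j)) (zero_add j) = f • e
  rw [Ext.mk₀_comp_mk₀_assoc, h', Ext.mk₀_smul, Ext.smul_comp, Ext.mk₀_id_comp]

/-- The restriction map from `Ext^j(M, ω)` to `Ext^j(⨁_{aᵢ ≥ 1} M_a, ω)` is surjective if and only
if the elements of `Ext^j(M, ω)` of degrees with `aᵢ = 1` are divisible by `xᵢ`. -/
lemma extMap_subtype_surjective_iff (hM : IsSq (k := k) ∅ ℳ) (P : GradedResolution (k := k) ℳ)
    (hP : ∀ j, IsSq (k := k) ∅ (P.deg j)) (i : Fin n) (j : ℕ) :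
    Function.Surjective (extMap (posPart hM.toIsGrading i).subtype j) ↔
      ∀ a : Fin n → ℤ, 0 ≤ a → a i = 0 →
        ∀ y ∈ extSubgroup (canonicalDeg k) hM.toIsGrading P j (a + Pi.single i 1),
          ∃ z ∈ extSubgroup (canonicalDeg k) hM.toIsGrading P j a,
            (X i : MvPolynomial (Fin n) k) • z = y := by
  obtain ⟨P', hP'⟩ := (hM.posPart i).exists_gradedResolution
  refine surjective_iff_of_comp_eq_X_smul (β := extMap (hM.mulX i) j) (isSq_extSubgroup hM P hP j)
    (isSq_extSubgroup (hM.posPart i) P' hP' j) (fun a ha => ?_) (fun a e he => ?_)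
    (fun a e he => ?_) (extMap_extMap ?_) (extMap_extMap ?_)
  · rw [eq_bot_iff]
    exact fun e he => eq_zero_of_mem_extSubgroup (hM.posPart i) P' hP' (Set.mem_singleton i) ha he
  · rw [add_comm]
    exact comp_mem_extDeg (hM.posPart i).toIsGrading hM.toIsGrading P'
      (hM.isHomogeneousMap_subtype i) he
  · rw [add_comm]
    exact comp_mem_extDeg hM.toIsGrading (hM.posPart i).toIsGrading P
      (hM.isHomogeneousMap_mulX i) he
  · ext y
    rfl
  · ext y
    rfl

variable (hM : IsGrading (k := k) ℳ) (i : Fin n)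

/-- The sequence `0 → ⨁_{aᵢ ≥ 1} M_a → M → M / ⨁_{aᵢ ≥ 1} M_a → 0`. -/
noncomputable abbrev posPartSequence : ShortComplex (ModuleCat.{u} (MvPolynomial (Fin n) k)) :=
  ModuleCat.shortComplexOfCompEqZero (posPart hM i).subtype (posPart hM i).mkQ
    (LinearMap.exact_subtype_mkQ (posPart hM i)).linearMap_comp_eq_zero

lemma shortExact_posPartSequence : (posPartSequence hM i).ShortExact :=
  ModuleCat.shortComplex_shortExact _ (LinearMap.exact_subtype_mkQ (posPart hM i))
    (Submodule.injective_subtype _) (Submodule.mkQ_surjective _)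

/-- `Ext^{j+1}` of the quotient contains the obstruction to surjectivity of the restriction map. -/
lemma extMap_subtype_surjective {j : ℕ} (h : Subsingleton (Ext
      (ModuleCat.of (MvPolynomial (Fin n) k) (M ⧸ posPart hM i)) (selfModule k n) (j + 1))) :
    Function.Surjective (extMap (posPart hM i).subtype j) := fun e =>
  Ext.contravariant_sequence_exact₁ (shortExact_posPartSequence hM i) (selfModule k n) e
    (add_comm 1 j) (Subsingleton.elim (α := Ext
      (ModuleCat.of (MvPolynomial (Fin n) k) (M ⧸ posPart hM i)) (selfModule k n) (j + 1)) _ _)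

lemma subsingleton_ext_quot_succ {j : ℕ}
    (hj : Subsingleton (Ext (ModuleCat.of (MvPolynomial (Fin n) k) M) (selfModule k n) (j + 1)))
    (h : Function.Surjective (extMap (posPart hM i).subtype j)) :
    Subsingleton (Ext (ModuleCat.of (MvPolynomial (Fin n) k) (M ⧸ posPart hM i))
      (selfModule k n) (j + 1)) := by
  refine subsingleton_of_forall_eq 0 fun e => ?_
  have hS := shortExact_posPartSequence hM i
  obtain ⟨e, rfl⟩ := Ext.contravariant_sequence_exact₃ hS (selfModule k n) e
    (Subsingleton.elim (α := Ext (ModuleCat.of (MvPolynomial (Fin n) k) M)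
      (selfModule k n) (j + 1)) _ _) (add_comm 1 j)
  obtain ⟨e, rfl⟩ := h e
  exact hS.extClass_comp_assoc e

lemma subsingleton_ext_quot_zero
    (hj : Subsingleton (Ext (ModuleCat.of (MvPolynomial (Fin n) k) M) (selfModule k n) 0)) :
    Subsingleton (Ext (ModuleCat.of (MvPolynomial (Fin n) k) (M ⧸ posPart hM i))
      (selfModule k n) 0) := by
  have hS := shortExact_posPartSequence hM i
  have := hS.epi_g
  exact (Ext.precomp_mk₀_injective_of_epi (selfModule k n) (posPartSequence hM i).g).subsingleton

/-- A Cohen–Macaulay squarefree module `M` of dimension `d` is `2`-Cohen–Macaulay if and only if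
`Ext^{n-d}(M, ω)` is generated in degree `0`. -/
theorem isHigherCohenMacaulay_two_iff {d : ℕ} (hM : IsSquarefree (k := k) ℳ)
    (hCM : IsCohenMacaulay (maxIdeal k n) M)
    (hd : Module.supportDim (MvPolynomial (Fin n) k) M = d) :
    IsHigherCohenMacaulay hM 2 ↔ ExtGeneratedInDegreeZero (k := k) ℳ (canonicalDeg k) (n - d) := by
  have hsq := hM.isSq
  have hfin := hM.finite
  obtain ⟨P, hP⟩ := hsq.exists_gradedResolution
  have hvan : ∀ j, n < j + d → Subsingleton (Abelian.Ext
      (ModuleCat.of (MvPolynomial (Fin n) k) M) (selfModule k n) j) := by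
    obtain ⟨rs, hrs, hreg, hl⟩ := exists_isRegular_of_isCohenMacaulay hCM hd
    exact fun j hj => hsq.subsingleton_ext hrs hreg.toIsWeaklyRegular (by omega)
  have hgen (j : ℕ) : ExtGeneratedInDegreeZero (k := k) ℳ (canonicalDeg k) j ↔
      ∀ i, Function.Surjective (extMap (posPart hM.toIsGrading i).subtype j) :=
    (span_degree_zero_eq_top_iff (isSq_extSubgroup hsq P hP j)).trans
      (forall_congr' fun i => (extMap_subtype_surjective_iff hsq P hP i j).symm)
  have hrestrict (i : Fin n) := isZeroOrCohenMacaulayOfDim_restrict_iff hM.toIsGrading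
    (V := ({i} : Set (Fin n))ᶜ) (N := M ⧸ posPart hM.toIsGrading i)
    (fun j hj y => by
      rw [Set.mem_compl_iff, not_not, Set.mem_singleton_iff] at hj
      subst hj
      exact X_smul_quot_posPart hsq j y)
    (posPart hM.toIsGrading i).mkQ (bijOn_mkQ_restrict hsq i)
    (Module.supportDim (MvPolynomial (Fin n) k) M)
  rw [hgen]
  constructor
  · intro h i
    refine extMap_subtype_surjective hM.toIsGrading i ?_
    have hi := h {i} (by simp)
    rw [Finset.coe_singleton, hrestrict i] at hi
    rcases hi with hi | ⟨hi, hdim⟩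
    -- on the zero module, sequences of arbitrary length are weakly regular
    · refine (hsq.quot i).subsingleton_ext (rs := List.replicate (n + 1) 0) ?_ ?_ ?_
      · intro r hr
        rw [List.eq_of_mem_replicate hr]
        exact zero_mem _
      · exact ⟨fun _ _ => fun y z _ => Subsingleton.elim y z⟩
      · rw [List.length_replicate]
        omega
    · obtain ⟨rs, hrs, hreg, hl⟩ := exists_isRegular_of_isCohenMacaulay hi (hdim.trans hd)
      exact (hsq.quot i).subsingleton_ext hrs hreg.toIsWeaklyRegular (by omega)
  · intro h W hW
    have hsurj : ∀ j, n ≤ j + d → ∀ i,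
        Function.Surjective (extMap (posPart hM.toIsGrading i).subtype j) := by
      intro j hj
      by_cases hjn : j = n - d
      · rw [hjn]
        exact h
      · rw [← hgen]
        have := hvan j (by omega)
        exact Subsingleton.elim _ _
    have hcases : W = ∅ ∨ ∃ i, W = {i} := by
      rw [← Finset.card_eq_zero, ← Finset.card_eq_one]
      omega
    rcases hcases with rfl | ⟨i, rfl⟩
    · rw [Finset.coe_empty, Set.compl_empty, isZeroOrCohenMacaulayOfDim_restrict_iff hM.toIsGrading
        (V := Set.univ) (fun i hi => absurd trivial hi) LinearMap.id
        ⟨fun _ _ => trivial, Set.injOn_id _, fun y _ => ⟨y, restrictAux_univ hsq y, rfl⟩⟩]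
      exact Or.inr ⟨hCM, rfl⟩
    · rw [Finset.coe_singleton, hrestrict i, or_iff_not_imp_left]
      intro hQ
      have := not_subsingleton_iff_nontrivial.1 hQ
      obtain ⟨rs, hl, hrs, hreg⟩ := (hsq.quot i).toIsGrading.exists_isRegular d fun j hj => by
        cases j with
        | zero => exact subsingleton_ext_quot_zero hM.toIsGrading i (hvan 0 hj)
        | succ j =>
          exact subsingleton_ext_quot_succ hM.toIsGrading i (hvan _ hj) (hsurj j (by omega) i)
      have := isCohenMacaulay_of_isRegular hrs hreg (by
        rw [hl, ← hd]
        exact Module.supportDim_le_of_surjective _ (Submodule.mkQ_surjective _))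
      rwa [hl, ← hd] at this

end Main

end SquarefreeModule

theorem corollary2p6 {k : Type u} [Field k] (n d : ℕ) {M : Type u} [AddCommGroup M]
    [Module (MvPolynomial (Fin n) k) M] (ℳ : (Fin n → ℤ) → AddSubgroup M)
    (hM : SquarefreeModule.IsSquarefree (k := k) ℳ)
    (hCM : SquarefreeModule.IsCohenMacaulay (SquarefreeModule.maxIdeal k n) M)
    (hd : Module.supportDim (MvPolynomial (Fin n) k) M = d) :
    SquarefreeModule.IsHigherCohenMacaulay hM 2 ↔
      SquarefreeModule.ExtGeneratedInDegreeZero (k := k) ℳ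
        (SquarefreeModule.canonicalDeg k) (n - d) := by
  exact SquarefreeModule.isHigherCohenMacaulay_two_iff hM hCM hd
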